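/- There is a constant $c_1>0$ such that for every constant $c_2$ there are two deterministic algorithms (a generator and an evaluator) for which the following holds. Let $n,n',p,q\in\mathbb N$ and $\varepsilon\in(0,1)$ with $n=n'p$, $n\ge p\ge q$ and $c_1\log_2\frac1\varepsilon\le q\le c_2\log_2\frac1\varepsilon$ (i.e. $q=\Theta(\log\frac1\varepsilon)$ with a sufficiently large hidden constant), and let $x\in\{0,1\}^n$, with consecutive blocks $x'[1],\dots,x'[n']\in\{0,1\}^p$. Given $n,p,q,x$ (the value of $\varepsilon$ is not needed), the generator outputs in time $\mathrm{poly}(n)$ a string $u$ of $O(\log n)$ bits that describes a sequence of $\varepsilon$-self-matching hash functions $h_1,\dots,h_{n'}:\{0,1\}^p\to\{0,1\}^q$ with respect to $x$. Given $n,p,q,u$, any $i\in\{1,\dots,n'\}$ and any $a\in\{0,1\}^p$, the evaluator outputs $h_i(a)$ in time $\mathrm{poly}(n)$. The polynomials and the constant in $O(\log n)$ depend only on $c_1,c_2$. Here $h_1,\dots,h_{n'}$ are called $\varepsilon$-self-matching with respect to $x$ if every (monotone) self-matching of $x$ has at most $\varepsilon n$ bad pairs. A self-matching of $x$ is a sequence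 of pairs $(i_1,j_1),\dots,(i_t,j_t)\in[n']\times[n]$ such that $i_1<\dots<i_t$, $j_l+p-1<j_{l+1}$ for $1\le l<t$, $j_l+p-1\le n$ for every $l$, and $h_{i_l}(x'[i_l])=h_{i_l}(x[j_l,j_l+p-1])$ for every $l$; the pair $(i_l,j_l)$ is bad if $x'[i_l]\ne x[j_l,j_l+p-1]$. Running time is measured on a random access machine with logarithmic cost (polynomially equivalent to multitape Turing machines). -/

import Mathlib

/-! ## Matchings under hash functions -/

/-- The substring of `y` of length `p` that starts at the (0-based) position `j`. Only used where
`j + p ≤ n`, so that the default value `false` never matters. -/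
def substr {n : ℕ} (y : Fin n → Bool) (j p : ℕ) : Fin p → Bool :=
  fun k => if h : j + k < n then y ⟨j + k, h⟩ else false

/-- Parsing a string of length `n = n' * p` into `n'` consecutive blocks of length `p`. -/
def blocks {n : ℕ} (x : Fin n → Bool) (n' p : ℕ) : Fin n' → Fin p → Bool :=
  fun i => substr x (i * p) p

/-- `w = ((i₁, j₁), …, (i_t, j_t))` is a monotone matching between the sequence of blocks `x'` and
the string `y` under the hash functions `h` (all indices are 0-based). -/
structure IsMatching {n n' p q : ℕ} (h : Fin n' → (Fin p → Bool) → (Fin q → Bool))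
    (x' : Fin n' → Fin p → Bool) (y : Fin n → Bool) (w : List (Fin n' × Fin n)) : Prop where
  /-- `i₁ < i₂ < ⋯ < i_t` -/
  left_lt : w.Pairwise fun a b => a.1 < b.1
  /-- `j₁ + p - 1 < j₂, …, j_{t-1} + p - 1 < j_t`: the matched substrings of `y` are disjoint and
  in order -/
  right_lt : w.Pairwise fun a b => (a.2 : ℕ) + p ≤ b.2
  /-- the matched substrings lie inside `y` -/
  right_le : ∀ a ∈ w, (a.2 : ℕ) + p ≤ n
  /-- matched pairs have equal hash values -/
  hash_eq : ∀ a ∈ w, h a.1 (x' a.1) = h a.1 (substr y a.2 p)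

/-- The number of bad pairs of `w`, i.e. pairs `(i, j)` with `x'[i] ≠ y[j, j + p - 1]`. -/
def numBad {n n' p : ℕ} (x' : Fin n' → Fin p → Bool) (y : Fin n → Bool)
    (w : List (Fin n' × Fin n)) : ℕ :=
  w.countP fun a => decide (x' a.1 ≠ substr y a.2 p)

/-- `h₁, …, h_{n'}` is a sequence of `ε`-self-matching hash functions with respect to
`x ∈ {0,1}^n` (where `n = n' * p`): every self-matching of `x` has at most `ε n` bad pairs. -/
def IsSelfMatching {n n' p q : ℕ} (ε : ℝ) (x : Fin n → Bool)
    (h : Fin n' → (Fin p → Bool) → (Fin q → Bool)) : Prop :=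
  ∀ w : List (Fin n' × Fin n), IsMatching h (blocks x n' p) x w →
    (numBad (blocks x n' p) x w : ℝ) ≤ ε * n

/-! ## Algorithms and their running time

Random access machines with logarithmic cost, with structured control flow. A machine has finitely
many scalar registers and arrays, holding natural numbers of any size; every operation is charged
the bit lengths of all the numbers (addresses included) that it handles, so that running times
agree with those of multitape Turing machines up to a polynomial. -/

namespace RAM

/-- Memory: `var v` is the content of the scalar register `v`, and `arr a k` that of cell `k` of
the array `a`. -/
structure Store where
  var : ℕ → ℕ
  arr : ℕ → ℕ → ℕ

/-- The arithmetic operations; subtraction is truncated, division is rounded down. -/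
inductive Op
  | add | sub | mul | div | mod

def Op.eval : Op → ℕ → ℕ → ℕ
  | add, a, b => a + b
  | sub, a, b => a - b
  | mul, a, b => a * b
  | div, a, b => a / b
  | mod, a, b => a % b

inductive Expr
  | const (c : ℕ)
  | var (v : ℕ)
  | get (a : ℕ) (index : Expr)
  | bin (op : Op) (e₁ e₂ : Expr)

def Expr.eval (s : Store) : Expr → ℕ
  | const c => c
  | var v => s.var v
  | get a e => s.arr a (e.eval s)
  | bin op e₁ e₂ => op.eval (e₁.eval s) (e₂.eval s)

/-- Logarithmic cost of evaluating an expression: one plus the bit length of the value, for each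
subexpression. -/
def Expr.cost (s : Store) : Expr → ℕ
  | const c => 1 + c.size
  | var v => 1 + (s.var v).size
  | get a e => e.cost s + 1 + (s.arr a (e.eval s)).size
  | bin op e₁ e₂ => e₁.cost s + e₂.cost s + 1 + (op.eval (e₁.eval s) (e₂.eval s)).size

/-- Programs. A condition holds if its value is not zero. -/
inductive Prog
  | skip
  | assign (v : ℕ) (e : Expr)
  | store (a : ℕ) (index e : Expr)
  | seq (c₁ c₂ : Prog)
  | ite (e : Expr) (c₁ c₂ : Prog)
  | while (e : Expr) (c : Prog)

def Store.setVar (s : Store) (v m : ℕ) : Store :=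
  { s with var := Function.update s.var v m }

def Store.setArr (s : Store) (a k m : ℕ) : Store :=
  { s with arr := Function.update s.arr a (Function.update (s.arr a) k m) }

/-- `Exec c s s' t`: started with memory `s`, the program `c` halts with memory `s'` after a run of
total cost `t`. -/
inductive Exec : Prog → Store → Store → ℕ → Prop
  | skip (s : Store) : Exec .skip s s 1
  | assign (s : Store) (v : ℕ) (e : Expr) :
      Exec (.assign v e) s (s.setVar v (e.eval s)) (1 + e.cost s)
  | store (s : Store) (a : ℕ) (i e : Expr) :
      Exec (.store a i e) s (s.setArr a (i.eval s) (e.eval s)) (1 + i.cost s + e.cost s)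
  | seq {c₁ c₂ : Prog} {s s' s'' : Store} {t₁ t₂ : ℕ} :
      Exec c₁ s s' t₁ → Exec c₂ s' s'' t₂ → Exec (.seq c₁ c₂) s s'' (t₁ + t₂)
  | ite_true {e : Expr} {c₁ c₂ : Prog} {s s' : Store} {t : ℕ} :
      e.eval s ≠ 0 → Exec c₁ s s' t → Exec (.ite e c₁ c₂) s s' (1 + e.cost s + t)
  | ite_false {e : Expr} {c₁ c₂ : Prog} {s s' : Store} {t : ℕ} :
      e.eval s = 0 → Exec c₂ s s' t → Exec (.ite e c₁ c₂) s s' (1 + e.cost s + t)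
  | while_true {e : Expr} {c : Prog} {s s' s'' : Store} {t₁ t₂ : ℕ} :
      e.eval s ≠ 0 → Exec c s s' t₁ → Exec (.while e c) s' s'' t₂ →
      Exec (.while e c) s s'' (1 + e.cost s + t₁ + t₂)
  | while_false {e : Expr} {c : Prog} {s : Store} :
      e.eval s = 0 → Exec (.while e c) s s (1 + e.cost s)

/-- The memory at the start: the numbers `nums` are in the scalar registers `0, 1, …`, the bits of
the strings `strs` are in the arrays `0, 1, …`, and everything else is `0`. -/
def Store.init (nums : List ℕ) (strs : List (List Bool)) : Store where
  var v := nums.getD v 0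
  arr a k := ((strs.getD a []).getD k false).toNat

/-- On the input `nums`, `strs` the program `c` halts, at cost at most `T`, with the bit string
`out` as output: its length in the scalar register `0` and its bits in the array `0`. -/
def Prog.OutputsInTime (c : Prog) (nums : List ℕ) (strs : List (List Bool)) (out : List Bool)
    (T : ℕ) : Prop :=
  ∃ (s : Store) (t : ℕ), Exec c (Store.init nums strs) s t ∧ t ≤ T ∧ s.var 0 = out.length ∧
    ∀ (k : ℕ) (hk : k < out.length), s.arr 0 k = (out[k]).toNat

end RAM

/-!
The hash functions come from a random linear form. For a prime `P` of polynomial size and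
`x, y ∈ ℤ / P`, block index `i` and a string `a` are mapped to the value
`v = ∑ k < p, a k * y * x ^ (i * p + k)` modulo `P`, and the hash value consists of the first `q`
digits of `v / P` after the binary point (`seedHash`). The triple `(P, x, y)` is the seed; it takes
`O(log n)` bits. The generator tries all seeds, without testing whether `P` is prime, computes for
each of them the largest number of bad pairs of a self-matching by dynamic programming
(`longestChain`, `score`), and outputs a best seed; the evaluator computes the linear form. Neither
needs `ε`, as it is enough to reach
`2 ^ (-(q / 100 + 1)) * n ≤ ε * n` bad pairs.

It remains to see that some seed is good (`exists_good_seed`). Consider `k` pairs `(i_l, j_l)` with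
distinct `i_l` and `x'[i_l] ≠ x[j_l, j_l + p - 1]`. The differences of the linear forms are
`y * D_l x`, where the polynomials `D_l` are linearly independent because they live in disjoint
ranges of degrees (`linearIndependent_diffPoly`). All pairs collide only if all values `y * D_l x`
are close to `0` modulo `P`. Bounding the indicator function of an arc by a Fejér kernel and
expanding into characters shows that, for every `S ≤ 2 ^ q / 6` with `n * S ^ k < P`, this happens
with probability at most `2 * 4 ^ k / S ^ k` (`card_mul_pow_le_of_close`). Thus the hash values
behave like independent ones as long as `q * k = O(log n)`, which a seed of `O(log n)` bits would
not allow for all pairs of a matching at once.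

So the argument is made local. Cut the blocks and the positions into intervals of length
`L ≈ 4 * k / ε`. A matching passes through at most `2 * n / L + 1` cells of this grid, so that one
with more than `ε * n` bad pairs has `k` of them in one cell (`IsBlockChain.exists_cell`). There are
only `n ^ 2 * (L.choose k) ^ 2` ways to choose `k` pairs in increasing order from one cell, and for
`k ≈ 8 * log n / q` the union bound applies (`exists_seed_forall_not_isBad`). When `q` exceeds
`12 * log n`, the same bound with `k = 1` excludes bad pairs altogether.

The programs are verified with a step-counting total-correctness calculus (`RAM.Reach`). The
logarithmic cost is obtained from the number of steps by a general argument: if every assignment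
lengthens the numbers in the memory only by a constant number of bits (`RAM.Prog.tame`), then `N`
steps cost at most a polynomial in `N` and the length of the input (`RAM.Run.exists_exec`).
-/

/-! ### Counting steps on the RAM -/

namespace RAM

/-- Unit-cost execution: `Run c s s' N` says that `c`, started in `s`, halts in `s'` after `N`
elementary steps. -/
inductive Run : Prog → Store → Store → ℕ → Prop
  | skip (s : Store) : Run .skip s s 1
  | assign (s : Store) (v : ℕ) (e : Expr) : Run (.assign v e) s (s.setVar v (e.eval s)) 1
  | store (s : Store) (a : ℕ) (i e : Expr) :
      Run (.store a i e) s (s.setArr a (i.eval s) (e.eval s)) 1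
  | seq {c₁ c₂ : Prog} {s s' s'' : Store} {t₁ t₂ : ℕ} :
      Run c₁ s s' t₁ → Run c₂ s' s'' t₂ → Run (.seq c₁ c₂) s s'' (t₁ + t₂)
  | ite_true {e : Expr} {c₁ c₂ : Prog} {s s' : Store} {t : ℕ} :
      e.eval s ≠ 0 → Run c₁ s s' t → Run (.ite e c₁ c₂) s s' (1 + t)
  | ite_false {e : Expr} {c₁ c₂ : Prog} {s s' : Store} {t : ℕ} :
      e.eval s = 0 → Run c₂ s s' t → Run (.ite e c₁ c₂) s s' (1 + t)
  | while_true {e : Expr} {c : Prog} {s s' s'' : Store} {t₁ t₂ : ℕ} :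
      e.eval s ≠ 0 → Run c s s' t₁ → Run (.while e c) s' s'' t₂ →
      Run (.while e c) s s'' (1 + t₁ + t₂)
  | while_false {e : Expr} {c : Prog} {s : Store} :
      e.eval s = 0 → Run (.while e c) s s 1

/-- Every number in the memory has at most `M` bits. -/
def Store.Bounded (s : Store) (M : ℕ) : Prop :=
  (∀ v, (s.var v).size ≤ M) ∧ ∀ a k, (s.arr a k).size ≤ M

theorem Store.Bounded.mono {s : Store} {M M' : ℕ} (h : s.Bounded M) (hM : M ≤ M') :
    s.Bounded M' :=
  ⟨fun v => (h.1 v).trans hM, fun a k => (h.2 a k).trans hM⟩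

theorem Store.Bounded.setVar {s : Store} {M v m : ℕ} (h : s.Bounded M) (hm : m.size ≤ M) :
    (s.setVar v m).Bounded M := by
  refine ⟨fun w => ?_, h.2⟩
  by_cases hw : w = v
  · subst hw; simpa [Store.setVar] using hm
  · simpa [Store.setVar, hw] using h.1 w

theorem Store.Bounded.setArr {s : Store} {M a k m : ℕ} (h : s.Bounded M) (hm : m.size ≤ M) :
    (s.setArr a k m).Bounded M := by
  refine ⟨h.1, fun b l => ?_⟩
  by_cases hb : b = a
  · subst hb
    by_cases hl : l = k
    · subst hl; simpa [Store.setArr] using hm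
    · simpa [Store.setArr, hl] using h.2 b l
  · simpa [Store.setArr, hb] using h.2 b l

theorem size_add_le (a b : ℕ) : (a + b).size ≤ max a.size b.size + 1 := by
  rw [Nat.size_le, pow_succ]
  have ha : a < 2 ^ max a.size b.size := Nat.size_le.1 (le_max_left _ _)
  have hb : b < 2 ^ max a.size b.size := Nat.size_le.1 (le_max_right _ _)
  omega

theorem size_mul_le (a b : ℕ) : (a * b).size ≤ a.size + b.size := by
  rcases Nat.eq_zero_or_pos b with rfl | hb
  · simp
  · rw [Nat.size_le, pow_add]
    exact Nat.mul_lt_mul_of_lt_of_le (Nat.lt_size_self a) (Nat.lt_size_self b).le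
      (by positivity)

theorem size_le_self (a : ℕ) : a.size ≤ a := Nat.size_le.2 Nat.lt_two_pow_self

theorem size_eval_op_le (op : Op) (a b : ℕ) : (op.eval a b).size ≤ a.size + b.size + 1 := by
  cases op
  · exact (size_add_le a b).trans (by omega)
  · exact (Nat.size_le_size (Nat.sub_le a b)).trans (by omega)
  · exact (size_mul_le a b).trans (by omega)
  · exact (Nat.size_le_size (Nat.div_le_self a b)).trans (by omega)
  · exact (Nat.size_le_size (Nat.mod_le a b)).trans (by omega)

/-- Evaluating a fixed expression costs at most a constant times the size of the largest number in
the memory. -/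
theorem Expr.exists_cost_le (e : Expr) :
    ∃ K, ∀ s M, Store.Bounded s M → e.cost s ≤ K * (M + 1) ∧ (e.eval s).size ≤ K * (M + 1) := by
  induction e with
  | const c =>
    refine ⟨1 + c.size, fun s M _ => ⟨?_, ?_⟩⟩ <;> simp only [Expr.cost, Expr.eval] <;> nlinarith
  | var v =>
    refine ⟨1, fun s M h => ⟨?_, ?_⟩⟩ <;> simp only [Expr.cost, Expr.eval] <;>
      linarith [h.1 v]
  | get a e ih =>
    obtain ⟨K, hK⟩ := ih
    refine ⟨K + 1, fun s M h => ?_⟩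
    have := h.2 a (e.eval s)
    have := hK s M h
    constructor <;> simp only [Expr.cost, Expr.eval] <;> nlinarith
  | bin op e₁ e₂ ih₁ ih₂ =>
    obtain ⟨K₁, h₁⟩ := ih₁
    obtain ⟨K₂, h₂⟩ := ih₂
    refine ⟨2 * K₁ + 2 * K₂ + 2, fun s M h => ?_⟩
    have := size_eval_op_le op (e₁.eval s) (e₂.eval s)
    have := h₁ s M h
    have := h₂ s M h
    constructor <;> simp only [Expr.cost, Expr.eval] <;> nlinarith

/-- A syntactic criterion for expressions whose value has only a constant number of bits more than
the largest number in the memory. Products of two registers are excluded unless they are reduced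
modulo some `e + c` with `c > 0`. -/
def Expr.tame : Expr → Bool
  | const _ => true
  | var _ => true
  | get _ _ => true
  | bin .add a b => a.tame && b.tame
  | bin .sub a _ => a.tame
  | bin .div a _ => a.tame
  | bin .mod _ (bin .add b (const (_ + 1))) => b.tame
  | bin .mod a _ => a.tame
  | bin .mul (const _) b => b.tame
  | bin .mul _ _ => false

theorem Expr.exists_size_le {e : Expr} (he : e.tame = true) :
    ∃ K, ∀ s M, Store.Bounded s M → (e.eval s).size ≤ M + K := by
  fun_induction Expr.tame e with
  | case1 c => exact ⟨c.size, fun s M _ => by simp [Expr.eval]⟩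
  | case2 v => exact ⟨0, fun s M h => h.1 v⟩
  | case3 a e => exact ⟨0, fun s M h => h.2 a _⟩
  | case4 a b iha ihb =>
    simp only [Bool.and_eq_true] at he
    obtain ⟨K₁, h₁⟩ := iha he.1
    obtain ⟨K₂, h₂⟩ := ihb he.2
    refine ⟨K₁ + K₂ + 1, fun s M h => ?_⟩
    have := size_add_le (a.eval s) (b.eval s)
    have := h₁ s M h
    have := h₂ s M h
    simp only [Expr.eval, Op.eval]
    omega
  | case5 a b ih =>
    obtain ⟨K, hK⟩ := ih he
    exact ⟨K, fun s M h => (Nat.size_le_size (Nat.sub_le _ _)).trans (hK s M h)⟩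
  | case6 a b ih =>
    obtain ⟨K, hK⟩ := ih he
    exact ⟨K, fun s M h => (Nat.size_le_size (Nat.div_le_self _ _)).trans (hK s M h)⟩
  | case7 a b c ih =>
    obtain ⟨K, hK⟩ := ih he
    refine ⟨K + (c + 1).size + 1, fun s M h => ?_⟩
    have h₁ : (Expr.bin .mod a (.bin .add b (.const c.succ))).eval s ≤ b.eval s + (c + 1) :=
      (Nat.mod_lt _ (Nat.succ_pos _)).le
    have := Nat.size_le_size h₁
    have := size_add_le (b.eval s) (c + 1)
    have := hK s M h
    omega
  | case8 a b _ ih =>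
    obtain ⟨K, hK⟩ := ih he
    exact ⟨K, fun s M h => (Nat.size_le_size (Nat.mod_le _ _)).trans (hK s M h)⟩
  | case9 c b ih =>
    obtain ⟨K, hK⟩ := ih he
    refine ⟨K + c.size, fun s M h => ?_⟩
    have := size_mul_le c (b.eval s)
    have := hK s M h
    simp only [Expr.eval, Op.eval]
    omega
  | case10 => simp at he

/-- All values written by the program are given by tame expressions. -/
def Prog.tame : Prog → Bool
  | skip => true
  | assign _ e => e.tame
  | store _ _ e => e.tame
  | seq c₁ c₂ => c₁.tame && c₂.tame
  | ite _ c₁ c₂ => c₁.tame && c₂.tame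
  | .while _ c => c.tame

/-- The constant `K` bounds the cost of every expression of the program and the growth of every
value it writes. -/
def Prog.BoundedBy (K : ℕ) : Prog → Prop
  | skip => True
  | assign _ e => (∀ s M, Store.Bounded s M → 1 + e.cost s ≤ K * (M + 1)) ∧
      ∀ s M, Store.Bounded s M → (e.eval s).size ≤ M + K
  | store _ i e =>
      (∀ s M, Store.Bounded s M → 1 + i.cost s + e.cost s ≤ K * (M + 1)) ∧
      ∀ s M, Store.Bounded s M → (e.eval s).size ≤ M + K
  | seq c₁ c₂ => c₁.BoundedBy K ∧ c₂.BoundedBy K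
  | ite e c₁ c₂ => (∀ s M, Store.Bounded s M → 1 + e.cost s ≤ K * (M + 1)) ∧
      c₁.BoundedBy K ∧ c₂.BoundedBy K
  | .while e c => (∀ s M, Store.Bounded s M → 1 + e.cost s ≤ K * (M + 1)) ∧ c.BoundedBy K

theorem Prog.BoundedBy.mono {K K' : ℕ} (hK : K ≤ K') {c : Prog} (h : c.BoundedBy K) :
    c.BoundedBy K' := by
  have key (M : ℕ) : K * (M + 1) ≤ K' * (M + 1) := Nat.mul_le_mul_right _ hK
  induction c with
  | skip => trivial
  | assign v e =>
    exact ⟨fun s M hs => (h.1 s M hs).trans (key M), fun s M hs => (h.2 s M hs).trans (by omega)⟩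
  | store a i e =>
    exact ⟨fun s M hs => (h.1 s M hs).trans (key M), fun s M hs => (h.2 s M hs).trans (by omega)⟩
  | seq c₁ c₂ ih₁ ih₂ => exact ⟨ih₁ h.1, ih₂ h.2⟩
  | ite e c₁ c₂ ih₁ ih₂ =>
    exact ⟨fun s M hs => (h.1 s M hs).trans (key M), ih₁ h.2.1, ih₂ h.2.2⟩
  | _ e c ih => exact ⟨fun s M hs => (h.1 s M hs).trans (key M), ih h.2⟩

theorem Prog.exists_boundedBy {c : Prog} (hc : c.tame = true) : ∃ K, c.BoundedBy K := by
  induction c with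
  | skip => exact ⟨0, trivial⟩
  | assign v e =>
    obtain ⟨K₁, h₁⟩ := e.exists_cost_le
    obtain ⟨K₂, h₂⟩ := Expr.exists_size_le hc
    refine ⟨K₁ + K₂ + 1, fun s M h => ?_, fun s M h => (h₂ s M h).trans (by omega)⟩
    have := (h₁ s M h).1
    nlinarith
  | store a i e =>
    obtain ⟨K₀, h₀⟩ := i.exists_cost_le
    obtain ⟨K₁, h₁⟩ := e.exists_cost_le
    obtain ⟨K₂, h₂⟩ := Expr.exists_size_le hc
    refine ⟨K₀ + K₁ + K₂ + 1, fun s M h => ?_, fun s M h => (h₂ s M h).trans (by omega)⟩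
    have := (h₀ s M h).1
    have := (h₁ s M h).1
    nlinarith
  | seq c₁ c₂ ih₁ ih₂ =>
    simp only [Prog.tame, Bool.and_eq_true] at hc
    obtain ⟨K₁, h₁⟩ := ih₁ hc.1
    obtain ⟨K₂, h₂⟩ := ih₂ hc.2
    exact ⟨K₁ + K₂, h₁.mono (by omega), h₂.mono (by omega)⟩
  | ite e c₁ c₂ ih₁ ih₂ =>
    simp only [Prog.tame, Bool.and_eq_true] at hc
    obtain ⟨K₀, h₀⟩ := e.exists_cost_le
    obtain ⟨K₁, h₁⟩ := ih₁ hc.1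
    obtain ⟨K₂, h₂⟩ := ih₂ hc.2
    refine ⟨K₀ + K₁ + K₂ + 1, fun s M h => ?_, h₁.mono (by omega), h₂.mono (by omega)⟩
    have := (h₀ s M h).1
    nlinarith
  | _ e c ih =>
    obtain ⟨K₀, h₀⟩ := e.exists_cost_le
    obtain ⟨K₁, h₁⟩ := ih hc
    refine ⟨K₀ + K₁ + 1, fun s M h => ?_, h₁.mono (by omega)⟩
    have := (h₀ s M h).1
    nlinarith

/-- Each step of a program with tame assignments lengthens the numbers in the memory by at most
`K` bits, so that `N` steps starting with `M`-bit numbers never meet a number of more than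
`M + K * N` bits, and the logarithmic cost is polynomial in `N` and `M`. -/
theorem Run.exists_exec {c : Prog} {s s' : Store} {N : ℕ} (h : Run c s s' N) {K : ℕ}
    (hc : c.BoundedBy (K + 1)) {M : ℕ} (hs : s.Bounded M) {R : ℕ} (hR : M + (K + 1) * N ≤ R) :
    s'.Bounded (M + (K + 1) * N) ∧ ∃ t, Exec c s s' t ∧ t ≤ N * ((K + 1) * (R + 1)) := by
  induction h generalizing M with
  | skip s =>
    refine ⟨hs.mono (by omega), 1, .skip s, ?_⟩
    nlinarith
  | assign s v e =>
    have hR' : M ≤ R := by omega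
    exact ⟨((hs.mono (by omega)).setVar (by simpa using hc.2 s M hs)), _, .assign s v e,
      by simpa using hc.1 s R (hs.mono hR')⟩
  | store s a i e =>
    have hR' : M ≤ R := by omega
    exact ⟨((hs.mono (by omega)).setArr (by simpa using hc.2 s M hs)), _, .store s a i e,
      by simpa using hc.1 s R (hs.mono hR')⟩
  | @seq c₁ c₂ s s₁ s₂ t₁ t₂ h₁ h₂ ih₁ ih₂ =>
    obtain ⟨b₁, u₁, e₁, l₁⟩ := ih₁ hc.1 hs (by nlinarith)
    obtain ⟨b₂, u₂, e₂, l₂⟩ := ih₂ hc.2 b₁ (by nlinarith)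
    refine ⟨b₂.mono (by nlinarith), _, .seq e₁ e₂, ?_⟩
    rw [add_mul]
    omega
  | @ite_true e c₁ c₂ s s₁ t he h₁ ih =>
    obtain ⟨b₁, u₁, e₁, l₁⟩ := ih hc.2.1 hs (by nlinarith)
    refine ⟨b₁.mono (by nlinarith), _, .ite_true he e₁, ?_⟩
    have := hc.1 s R (hs.mono (by omega))
    rw [add_mul, one_mul]
    omega
  | @ite_false e c₁ c₂ s s₁ t he h₁ ih =>
    obtain ⟨b₁, u₁, e₁, l₁⟩ := ih hc.2.2 hs (by nlinarith)
    refine ⟨b₁.mono (by nlinarith), _, .ite_false he e₁, ?_⟩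
    have := hc.1 s R (hs.mono (by omega))
    rw [add_mul, one_mul]
    omega
  | @while_true e c s s₁ s₂ t₁ t₂ he h₁ h₂ ih₁ ih₂ =>
    obtain ⟨b₁, u₁, e₁, l₁⟩ := ih₁ hc.2 hs (by nlinarith)
    obtain ⟨b₂, u₂, e₂, l₂⟩ := ih₂ hc b₁ (by nlinarith)
    refine ⟨b₂.mono (by nlinarith), _, .while_true he e₁ e₂, ?_⟩
    have := hc.1 s R (hs.mono (by omega))
    rw [add_mul, add_mul, one_mul]
    omega
  | @while_false e c s he =>
    refine ⟨hs.mono (by omega), _, .while_false he, ?_⟩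
    have := hc.1 s R (hs.mono (by omega))
    rw [one_mul]
    omega

/-! ### Total correctness with step counts -/

/-- Whether the program contains an assignment to the scalar register `v`. -/
def Prog.writesVar (v : ℕ) : Prog → Bool
  | skip => false
  | assign w _ => v == w
  | store _ _ _ => false
  | seq c₁ c₂ => c₁.writesVar v || c₂.writesVar v
  | ite _ c₁ c₂ => c₁.writesVar v || c₂.writesVar v
  | .while _ c => c.writesVar v

/-- Whether the program contains a store to the array `a`. -/
def Prog.writesArr (a : ℕ) : Prog → Bool
  | skip => false
  | assign _ _ => false
  | store b _ _ => a == b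
  | seq c₁ c₂ => c₁.writesArr a || c₂.writesArr a
  | ite _ c₁ c₂ => c₁.writesArr a || c₂.writesArr a
  | .while _ c => c.writesArr a

/-- `s` and `s'` agree on everything that `c` does not write to. -/
structure Frame (c : Prog) (s s' : Store) : Prop where
  var : ∀ v, c.writesVar v = false → s'.var v = s.var v
  arr : ∀ a, c.writesArr a = false → s'.arr a = s.arr a

@[simp] theorem Store.setVar_var (s : Store) (v m w : ℕ) :
    (s.setVar v m).var w = if w = v then m else s.var w := by
  simp [Store.setVar, Function.update_apply]

@[simp] theorem Store.setVar_arr (s : Store) (v m : ℕ) : (s.setVar v m).arr = s.arr := rfl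

@[simp] theorem Store.setArr_var (s : Store) (a k m : ℕ) : (s.setArr a k m).var = s.var := rfl

@[simp] theorem Store.setArr_arr (s : Store) (a k m b l : ℕ) :
    (s.setArr a k m).arr b l = if b = a ∧ l = k then m else s.arr b l := by
  by_cases hb : b = a
  · subst hb; simp [Store.setArr, Function.update_apply]
  · simp [Store.setArr, hb]

theorem Run.frame {c : Prog} {s s' : Store} {N : ℕ} (h : Run c s s' N) : Frame c s s' := by
  induction h with
  | skip s => exact ⟨fun _ _ => rfl, fun _ _ => rfl⟩
  | assign s v e =>
    refine ⟨fun w hw => ?_, fun _ _ => rfl⟩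
    simp only [Prog.writesVar, beq_eq_false_iff_ne] at hw
    simp [hw]
  | store s a i e =>
    refine ⟨fun _ _ => rfl, fun b hb => ?_⟩
    simp only [Prog.writesArr, beq_eq_false_iff_ne] at hb
    funext k
    simp [hb]
  | seq _ _ ih₁ ih₂ =>
    refine ⟨fun v hv => ?_, fun a ha => ?_⟩
    · simp only [Prog.writesVar, Bool.or_eq_false_iff] at hv
      rw [ih₂.var v hv.2, ih₁.var v hv.1]
    · simp only [Prog.writesArr, Bool.or_eq_false_iff] at ha
      rw [ih₂.arr a ha.2, ih₁.arr a ha.1]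
  | ite_true _ _ ih =>
    exact ⟨fun v hv => ih.var v (Bool.or_eq_false_iff.1 hv).1,
      fun a ha => ih.arr a (Bool.or_eq_false_iff.1 ha).1⟩
  | ite_false _ _ ih =>
    exact ⟨fun v hv => ih.var v (Bool.or_eq_false_iff.1 hv).2,
      fun a ha => ih.arr a (Bool.or_eq_false_iff.1 ha).2⟩
  | while_true _ _ _ ih₁ ih₂ =>
    exact ⟨fun v hv => (ih₂.var v hv).trans (ih₁.var v hv),
      fun a ha => (ih₂.arr a ha).trans (ih₁.arr a ha)⟩
  | while_false _ => exact ⟨fun _ _ => rfl, fun _ _ => rfl⟩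

/-- Started in `s`, the program `c` halts after at most `N` steps in a memory satisfying `Q`. -/
def Reach (c : Prog) (s : Store) (N : ℕ) (Q : Store → Prop) : Prop :=
  ∃ s' t, Run c s s' t ∧ t ≤ N ∧ Q s'

theorem Reach.mono {c : Prog} {s : Store} {N N' : ℕ} {Q Q' : Store → Prop}
    (h : Reach c s N Q) (hN : N ≤ N') (hQ : ∀ s', Frame c s s' → Q s' → Q' s') :
    Reach c s N' Q' := by
  obtain ⟨s', t, hr, ht, hq⟩ := h
  exact ⟨s', t, hr, ht.trans hN, hQ s' hr.frame hq⟩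

theorem Reach.skip {s : Store} {Q : Store → Prop} (h : Q s) : Reach .skip s 1 Q :=
  ⟨s, 1, .skip s, le_rfl, h⟩

theorem Reach.assign {s : Store} {v : ℕ} {e : Expr} {Q : Store → Prop}
    (h : Q (s.setVar v (e.eval s))) : Reach (.assign v e) s 1 Q :=
  ⟨_, 1, .assign s v e, le_rfl, h⟩

theorem Reach.store {s : Store} {a : ℕ} {i e : Expr} {Q : Store → Prop}
    (h : Q (s.setArr a (i.eval s) (e.eval s))) : Reach (.store a i e) s 1 Q :=
  ⟨_, 1, .store s a i e, le_rfl, h⟩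

theorem Reach.seq {c₁ c₂ : Prog} {s : Store} {N₁ N₂ : ℕ} {Q : Store → Prop}
    (h : Reach c₁ s N₁ fun s' => Reach c₂ s' N₂ Q) : Reach (.seq c₁ c₂) s (N₁ + N₂) Q := by
  obtain ⟨s', t, hr, ht, s'', t', hr', ht', hq⟩ := h
  exact ⟨s'', _, hr.seq hr', by omega, hq⟩

theorem Reach.ite {e : Expr} {c₁ c₂ : Prog} {s : Store} {N : ℕ} {Q : Store → Prop}
    (h₁ : e.eval s ≠ 0 → Reach c₁ s N Q) (h₂ : e.eval s = 0 → Reach c₂ s N Q) :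
    Reach (.ite e c₁ c₂) s (N + 1) Q := by
  by_cases he : e.eval s = 0
  · obtain ⟨s', t, hr, ht, hq⟩ := h₂ he
    exact ⟨s', _, .ite_false he hr, by omega, hq⟩
  · obtain ⟨s', t, hr, ht, hq⟩ := h₁ he
    exact ⟨s', _, .ite_true he hr, by omega, hq⟩

theorem Reach.assign_seq {s : Store} {v : ℕ} {e : Expr} {c : Prog} {N : ℕ} {Q : Store → Prop}
    (h : Reach c (s.setVar v (e.eval s)) N Q) : Reach (.seq (.assign v e) c) s (N + 1) Q := by
  rw [add_comm]
  exact .seq (.assign h)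

theorem Reach.then {c₁ c₂ : Prog} {s : Store} {N₁ N₂ : ℕ} {Q₁ Q : Store → Prop}
    (h₁ : Reach c₁ s N₁ Q₁) (h₂ : ∀ s', Frame c₁ s s' → Q₁ s' → Reach c₂ s' N₂ Q) :
    Reach (.seq c₁ c₂) s (N₂ + N₁) Q := by
  rw [add_comm]
  exact .seq (h₁.mono le_rfl h₂)

/-- `for v = 0, …, e - 1 do c` -/
def Prog.loop (v : ℕ) (e : Expr) (c : Prog) : Prog :=
  .seq (.assign v (.const 0))
    (.while (.bin .sub e (.var v)) (.seq c (.assign v (.bin .add (.var v) (.const 1)))))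

/-- The loop rule. The hypothesis `he` says that neither the program nor the loop counter
influences the number of iterations. -/
theorem Reach.loop {v : ℕ} {e : Expr} {c : Prog} {s : Store} {n N : ℕ} (I : ℕ → Store → Prop)
    (hv : c.writesVar v = false)
    (he : ∀ s', Frame (Prog.loop v e c) s s' → e.eval s' = n)
    (h₀ : I 0 (s.setVar v 0))
    (hI : ∀ k < n, ∀ s', Frame (Prog.loop v e c) s s' → s'.var v = k → I k s' →
      Reach c s' N fun s'' => I (k + 1) (s''.setVar v (k + 1))) :
    Reach (Prog.loop v e c) s (n * (N + 2) + 2) fun s' => s'.var v = n ∧ I n s' := by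
  have key : ∀ m k s', k + m = n → Frame (Prog.loop v e c) s s' → s'.var v = k → I k s' →
      Reach (.while (.bin .sub e (.var v)) (.seq c (.assign v (.bin .add (.var v) (.const 1)))))
        s' (m * (N + 2) + 1) fun s' => s'.var v = n ∧ I n s' := by
    intro m
    induction m with
    | zero =>
      intro k s' hk hf hvk hIk
      obtain rfl : k = n := by omega
      refine ⟨s', 1, .while_false ?_, by omega, hvk, hIk⟩
      simp [Expr.eval, Op.eval, he s' hf, hvk]
    | succ m ih =>
      intro k s' hk hf hvk hIk
      obtain ⟨s₁, t₁, hr₁, ht₁, hq₁⟩ := hI k (by omega) s' hf hvk hIk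
      have hv₁ : s₁.var v = k := by rw [hr₁.frame.var v hv, hvk]
      have hr₂ : Run (.assign v (.bin .add (.var v) (.const 1))) s₁ (s₁.setVar v (k + 1)) 1 := by
        simpa [Expr.eval, Op.eval, hv₁] using
          Run.assign s₁ v (.bin .add (.var v) (.const 1))
      have hf₂ : Frame (Prog.loop v e c) s (s₁.setVar v (k + 1)) := by
        have hf₁ := (hr₁.seq hr₂).frame
        refine ⟨fun w hw => ?_, fun a ha => ?_⟩
        · rw [hf₁.var w, hf.var w hw]
          simpa [Prog.loop, Prog.writesVar] using
            ((by simpa [Prog.loop, Prog.writesVar, and_comm] using hw :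
              ¬ w = v ∧ c.writesVar w = false)).symm
        · rw [hf₁.arr a, hf.arr a ha]
          simpa [Prog.loop, Prog.writesArr] using ha
      obtain ⟨s₃, t₃, hr₃, ht₃, hq₃⟩ := ih (k + 1) _ (by omega) hf₂ (by simp) hq₁
      refine ⟨s₃, _, .while_true ?_ (hr₁.seq hr₂) hr₃, ?_, hq₃⟩
      · simp only [Expr.eval, Op.eval, he s' hf, hvk]
        omega
      · rw [add_mul]
        omega
  have hf : Frame (Prog.loop v e c) s (s.setVar v 0) := by
    refine ⟨fun w hw => ?_, fun a _ => rfl⟩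
    have : w ≠ v := by
      rintro rfl
      simp [Prog.loop, Prog.writesVar] at hw
    simp [this]
  obtain ⟨s', t, hr, ht, hq⟩ := key n 0 _ (by omega) hf (by simp) h₀
  exact ⟨s', _, .seq (.assign s v (.const 0)) hr, by omega, hq⟩

/-- A tame program that halts after `N` steps outputs its result in time polynomial in `N` and the
bit lengths of the inputs. -/
theorem Reach.outputsInTime {c : Prog} {nums : List ℕ} {strs : List (List Bool)}
    {out : List Bool} {N K M T : ℕ}
    (h : Reach c (Store.init nums strs) N fun s =>
      s.var 0 = out.length ∧ ∀ (k : ℕ) (hk : k < out.length), s.arr 0 k = (out[k]).toNat)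
    (hc : c.BoundedBy (K + 1)) (hM : ∀ m ∈ nums, m ≤ M)
    (hT : N * ((K + 1) * (M + 1 + (K + 1) * N + 1)) ≤ T) :
    c.OutputsInTime nums strs out T := by
  obtain ⟨s', t, hr, ht, hq⟩ := h
  have hs : (Store.init nums strs).Bounded (M + 1) := by
    refine ⟨fun v => ?_, fun a k => ?_⟩
    · refine (size_le_self _).trans ?_
      change nums.getD v 0 ≤ M + 1
      rw [List.getD_eq_getElem?_getD]
      rcases lt_or_ge v nums.length with hv | hv
      · simpa [hv] using (hM _ (List.getElem_mem hv)).trans (Nat.le_succ M)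
      · simp [hv]
    · refine (size_le_self _).trans ((Bool.toNat_le _).trans (by omega))
  obtain ⟨-, u, hu, hle⟩ := hr.exists_exec hc hs
    (R := M + 1 + (K + 1) * N) (by gcongr)
  exact ⟨s', u, hu, (hle.trans (by gcongr)).trans hT, hq⟩

end RAM

/-! ### The hash functions -/

/-- The linear form `∑ k < p, a k * y * x ^ (e + k)`, reduced modulo `P`. -/
def hashMod (P x y e : ℕ) (a : ℕ → ℕ) (p : ℕ) : ℕ :=
  (∑ k ∈ Finset.range p, a k * (y * x ^ (e + k))) % P

/-- The number whose binary digits are the first `q` digits after the binary point of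
`hashMod P x y e a p / P`. -/
def hashNat (P x y e : ℕ) (a : ℕ → ℕ) (p q : ℕ) : ℕ :=
  hashMod P x y e a p * 2 ^ q / P

/-- The hash value under the seed `z < N ^ 3`, whose base-`N` digits encode the modulus `P` and the
parameters `x` and `y` of the linear form. The digits are shifted so that `P ≥ 2` and
`x, y ≥ 1`; the seed `0` stands for `P = 2`, `x = y = 1`. -/
def seedHash (N z e : ℕ) (a : ℕ → ℕ) (p q : ℕ) : ℕ :=
  hashNat (z % N + 2) (z / N % N + 1) (z / N / N + 1) e a p q

/-- The logarithm of the range `N` of the parameters is `22 * Nat.clog 2 n`. -/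
def seedRange (n : ℕ) : ℕ := 2 ^ (22 * Nat.clog 2 n)

/-! ### The dynamic program for the longest matching -/

/-- If `g i j` says that block `i` may be matched with the substring at `j`, then
`longestChain p g i j` is the largest size of a monotone matching of the first `i` blocks with
disjoint substrings inside the first `j` positions. -/
def longestChain (p : ℕ) (g : ℕ → ℕ → Bool) : ℕ → ℕ → ℕ
  | 0, _ => 0
  | i + 1, j => (Finset.range (j + 1)).sup fun l =>
      max (longestChain p g i l)
        (if p ≤ l ∧ g i (l - p) = true then longestChain p g i (l - p) + 1 else 0)

namespace RAM

/-! ### The hashing subroutine and the evaluator -/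

instance : Add Expr := ⟨.bin .add⟩
instance : Sub Expr := ⟨.bin .sub⟩
instance : Mul Expr := ⟨.bin .mul⟩
instance : Div Expr := ⟨.bin .div⟩
instance : Mod Expr := ⟨.bin .mod⟩
instance (c : ℕ) : OfNat Expr c := ⟨.const c⟩

infixr:60 " ;; " => Prog.seq

@[simp] theorem Expr.eval_var (s : Store) (v : ℕ) : (Expr.var v).eval s = s.var v := rfl
@[simp] theorem Expr.eval_const (s : Store) (c : ℕ) : (Expr.const c).eval s = c := rfl
@[simp] theorem Expr.eval_get (s : Store) (a : ℕ) (e : Expr) :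
    (Expr.get a e).eval s = s.arr a (e.eval s) := rfl
@[simp] theorem Expr.eval_add (s : Store) (a b : Expr) : (a + b).eval s = a.eval s + b.eval s := rfl
@[simp] theorem Expr.eval_sub (s : Store) (a b : Expr) : (a - b).eval s = a.eval s - b.eval s := rfl
@[simp] theorem Expr.eval_mul (s : Store) (a b : Expr) : (a * b).eval s = a.eval s * b.eval s := rfl
@[simp] theorem Expr.eval_div (s : Store) (a b : Expr) : (a / b).eval s = a.eval s / b.eval s := rfl
@[simp] theorem Expr.eval_mod (s : Store) (a b : Expr) : (a % b).eval s = a.eval s % b.eval s := rfl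
@[simp] theorem Expr.eval_ofNat (s : Store) (c : ℕ) :
    (ofNat(c) : Expr).eval s = OfNat.ofNat c := rfl

/-- Registers `5`, `6`, `7`, `8` receive `2 ^ l`, `2 ^ (22 * l)`, `2 ^ (66 * l)`, `66 * l`, where
`l` is the rounded-up binary logarithm of the number in register `0`. -/
def setupProg : Prog :=
  .assign 5 1 ;; .assign 6 1 ;; .assign 7 1 ;; .assign 8 0 ;;
  .loop 9 (.var 0) (.ite (.var 0 - .var 5)
    (.assign 5 (2 * .var 5) ;; .assign 6 (.const (2 ^ 22) * .var 6) ;;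
      .assign 7 (.const (2 ^ 66) * .var 7) ;; .assign 8 (.var 8 + 66))
    .skip)

/-- Registers `10`, `11`, `12` receive the base-`N` digits of register `14`, where `N` is in
register `6`. -/
def decodeProg : Prog :=
  .assign 10 (.var 14 % .var 6) ;; .assign 11 (.var 14 / .var 6 % .var 6) ;;
  .assign 12 (.var 14 / .var 6 / .var 6)

/-- Register `out` receives the hash value of the `p` cells of array `A` that start at the position
in register `off`; the parameters of the hash function are in the registers `10`, `11`, `12`, the
exponent `e` in register `13`, and `p` and `q` in the registers `1` and `2`. -/
def hashProg (A off out : ℕ) : Prog :=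
  .assign 21 ((.var 12 + 1) % (.var 10 + 2)) ;;
  .loop 20 (.var 13) (.assign 21 (.var 21 * (.var 11 + 1) % (.var 10 + 2))) ;;
  .assign 22 0 ;;
  .loop 20 (.var 1)
    (.assign 22 ((.var 22 + .get A (.var off + .var 20) * .var 21) % (.var 10 + 2)) ;;
      .assign 21 (.var 21 * (.var 11 + 1) % (.var 10 + 2))) ;;
  .loop 20 (.var 2) (.assign 22 (2 * .var 22)) ;;
  .assign out (.var 22 / (.var 10 + 2))

theorem reach_hashProg (A off out : ℕ) (s : Store) {B : ℕ} (h₂₀ : off ≠ 20) (h₂₁ : off ≠ 21)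
    (h₂₂ : off ≠ 22) (h13 : s.var 13 ≤ B) (h1 : s.var 1 ≤ B) (h2 : s.var 2 ≤ B) :
    Reach (hashProg A off out) s (10 * B + 9) fun s' => s'.var out =
      hashNat (s.var 10 + 2) (s.var 11 + 1) (s.var 12 + 1) (s.var 13)
        (fun k => s.arr A (s.var off + k)) (s.var 1) (s.var 2) := by
  set P := s.var 10 + 2 with hP
  set x := s.var 11 + 1 with hx
  set y := s.var 12 + 1 with hy
  have step (t : ℕ) : (y * x ^ t) % P * x % P = (y * x ^ (t + 1)) % P := by
    rw [pow_succ, ← mul_assoc, Nat.mod_mul_mod]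
  refine Reach.mono (N := 1 + (s.var 2 * (1 + 2) + 2) + (s.var 1 * (1 + 1 + 2) + 2) + 1 +
    (s.var 13 * (1 + 2) + 2) + 1) ?_ (by omega) fun _ _ h => h
  refine .assign_seq (.then (.loop (fun k s' => s'.var 21 = (y * x ^ k) % P) rfl ?_ ?_ ?_)
    fun s₁ f₁ q₁ => .assign_seq ?_)
  · intro s' hf
    simpa using hf.var 13 rfl
  · simp [hP, hy]
  · intro k hk s' hf hv hI
    have e10 := hf.var 10 rfl
    have e11 := hf.var 11 rfl
    simp only [Store.setVar_var] at e10 e11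
    refine .assign ?_
    simp [hI, e10, e11, ← hP, ← hx, step]
  have e21 := q₁.2
  have e10 := f₁.var 10 rfl
  have e11 := f₁.var 11 rfl
  have e1 := f₁.var 1 rfl
  have e2 := f₁.var 2 rfl
  have eo : s₁.var off = s.var off := by
    rw [f₁.var off (by simp [Prog.loop, Prog.writesVar, h₂₀, h₂₁])]
    simp [h₂₁]
  have ea := f₁.arr A rfl
  simp only [Store.setVar_var, Store.setVar_arr] at e10 e11 e1 e2 ea
  norm_num at e10 e11 e1 e2
  refine .then (.loop (fun k s' => s'.var 22 = hashMod P x y (s.var 13)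
    (fun k => s.arr A (s.var off + k)) k ∧ s'.var 21 = (y * x ^ (s.var 13 + k)) % P)
    rfl ?_ ?_ ?_) fun s₂ f₂ q₂ => ?_
  · intro s' hf
    simpa [e1] using hf.var 1 rfl
  · simp [hashMod, e21]
  · intro k hk s' hf hv hI
    have g10 := hf.var 10 rfl
    have g11 := hf.var 11 rfl
    have ga := hf.arr A rfl
    have go : s'.var off = s.var off := by
      rw [hf.var off (by simp [Prog.loop, Prog.writesVar, h₂₀, h₂₁, h₂₂]), ← eo]
      simp [h₂₂]
    simp only [Store.setVar_var, Store.setVar_arr] at g10 g11 ga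
    norm_num [e10, e11, ea] at g10 g11 ga
    refine .assign_seq (.assign ?_)
    simp only [Store.setVar_var, Expr.eval_var, Expr.eval_mul, Expr.eval_add,
      Expr.eval_mod, Expr.eval_get, Expr.eval_ofNat, hI.1, hI.2, go, ga, g10, g11, hv]
    norm_num [← hP, ← hx, step]
    constructor
    · simp [hashMod, Finset.sum_range_succ, Nat.add_mod, Nat.mul_mod]
    · rw [add_assoc]
  have i22 := q₂.2.1
  have i10 := f₂.var 10 rfl
  have i2 := f₂.var 2 rfl
  simp only [Store.setVar_var] at i10 i2
  norm_num [e10, e2] at i10 i2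
  refine .then (.loop (n := s.var 2) (fun k s' => s'.var 22 = hashMod P x y (s.var 13)
    (fun k => s.arr A (s.var off + k)) (s.var 1) * 2 ^ k) rfl ?_ ?_ ?_)
    fun s₃ f₃ q₃ => .assign ?_
  · intro s' hf
    simpa [i2] using hf.var 2 rfl
  · simp [i22]
  · intro k hk s' hf hv hI
    refine .assign ?_
    simp [hI, pow_succ]
    ring
  · simp [q₃.2, f₃.var 10 rfl, i10, hashNat, hP]

theorem reach_setupProg (s : Store) : Reach setupProg s (7 * s.var 0 + 6) fun s' =>
    s'.var 6 = seedRange (s.var 0) ∧ s'.var 7 = 2 ^ (66 * Nat.clog 2 (s.var 0)) ∧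
      s'.var 8 = 66 * Nat.clog 2 (s.var 0) := by
  set n := s.var 0 with hn
  set l := Nat.clog 2 n with hl
  have hln : l ≤ n := Nat.clog_le_of_le_pow Nat.lt_two_pow_self.le
  refine Reach.mono (N := n * (4 + 1 + 2) + 2 + 1 + 1 + 1 + 1) (.assign_seq (.assign_seq
    (.assign_seq (.assign_seq (.loop (n := n) (fun k s' => s'.var 5 = 2 ^ min k l ∧
      s'.var 6 = 2 ^ (22 * min k l) ∧ s'.var 7 = 2 ^ (66 * min k l) ∧ s'.var 8 = 66 * min k l)
      rfl ?_ ?_ ?_))))) (by omega) ?_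
  · intro s' hf
    simpa using hf.var 0 rfl
  · simp
  · rintro k hk s' hf hv ⟨h5, h6, h7, h8⟩
    have e0 : s'.var 0 = n := by simpa using hf.var 0 rfl
    have hlt : k < l ↔ 2 ^ k < n := Nat.lt_clog_iff_pow_lt (by norm_num)
    refine .ite (fun he => ?_) fun he => .mono (.skip ?_) (N := 1) (by norm_num) fun _ _ h => h
    · have hkl : k < l := by
        by_contra! hle
        rw [Expr.eval_sub, Expr.eval_var, Expr.eval_var, e0, h5, min_eq_right hle] at he
        have : n ≤ 2 ^ l := Nat.le_pow_clog (by norm_num) n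
        omega
      refine .assign_seq (N := 3) (.assign_seq (N := 2) (.assign_seq (.assign ?_)))
      rw [min_eq_left hkl.le] at h5 h6 h7 h8
      rw [min_eq_left (Nat.succ_le_of_lt hkl)]
      simp [h5, h6, h7, h8]
      refine ⟨?_, ?_, ?_, ?_⟩ <;> ring
    · have hkl : l ≤ k := by
        by_contra! hlt'
        rw [Expr.eval_sub, Expr.eval_var, Expr.eval_var, e0, h5, min_eq_left hlt'.le] at he
        have := hlt.1 hlt'
        omega
      rw [min_eq_right hkl] at h5 h6 h7 h8
      rw [min_eq_right (hkl.trans (Nat.le_succ k))]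
      simp [h5, h6, h7, h8]
  · rintro s' - ⟨-, h5, h6, h7, h8⟩
    rw [min_eq_right hln] at h6 h7 h8
    exact ⟨h6, h7, h8⟩

theorem reach_decodeProg (s : Store) : Reach decodeProg s 3 fun s' =>
    s'.var 10 = s.var 14 % s.var 6 ∧ s'.var 11 = s.var 14 / s.var 6 % s.var 6 ∧
      s'.var 12 = s.var 14 / s.var 6 / s.var 6 := by
  refine .assign_seq (N := 2) (.assign_seq (.assign ?_))
  simp

/-- The evaluator. Register `14` collects the seed, whose digits are read from the top, and register
`13` receives the exponent `i * p`. This number is less than `n + 1`, so that the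
reduction modulo `n + 1` does not change it and only serves to keep the program tame. -/
def evalProg : Prog :=
  setupProg ;; .assign 15 0 ;; .assign 14 0 ;;
  .loop 9 (.var 4) (.assign 14 (2 * .var 14 + .get 0 (.var 4 - 1 - .var 9))) ;;
  decodeProg ;; .assign 13 (.var 3 * .var 1 % (.var 0 + 1)) ;; hashProg 1 15 16 ;;
  .loop 9 (.var 2) (.store 0 (.var 9) (.var 16 % 2) ;; .assign 16 (.var 16 / 2)) ;;
  .assign 0 (.var 2)

theorem reach_evalProg (s : Store) {z : ℕ} (hz : z < 2 ^ s.var 4)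
    (hb : ∀ k < s.var 4, s.arr 0 k = z / 2 ^ k % 2) (h1 : s.var 1 ≤ s.var 0)
    (h2 : s.var 2 ≤ s.var 0) (h3 : s.var 3 * s.var 1 ≤ s.var 0) :
    Reach evalProg s (21 * s.var 0 + 3 * s.var 4 + 40) fun s' => s'.var 0 = s.var 2 ∧
      ∀ k < s.var 2, s'.arr 0 k =
        seedHash (seedRange (s.var 0)) z (s.var 3 * s.var 1) (s.arr 1) (s.var 1) (s.var 2)
          / 2 ^ k % 2 := by
  set n := s.var 0 with hn
  set m := s.var 4 with hm
  refine .mono (N := 1 + (s.var 2 * (1 + 1 + 2) + 2) + (10 * n + 9) + 1 + 3 +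
    (m * (1 + 2) + 2) + 1 + 1 + (7 * n + 6)) ?_ (by omega) fun _ _ h => h
  refine .then (reach_setupProg s) fun s₁ f₁ q₁ => .assign_seq (.assign_seq (.then
    (.loop (n := m) (fun k s' => s'.var 14 = z / 2 ^ (m - k)) rfl ?_ ?_ ?_) fun s₂ f₂ q₂ => ?_))
  · intro s' hf
    simpa [f₁.var 4 rfl] using hf.var 4 rfl
  · simp [Nat.div_eq_of_lt hz]
  · intro k hk s' hf hv hI
    have e4 : s'.var 4 = m := by simpa [f₁.var 4 rfl] using hf.var 4 rfl
    have ea : s'.arr 0 = s.arr 0 := by simpa [f₁.arr 0 rfl] using hf.arr 0 rfl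
    refine .assign ?_
    have hidx : m - 1 - k = m - (k + 1) := by omega
    simp only [Expr.eval_add, Expr.eval_mul, Expr.eval_ofNat, Expr.eval_var, Expr.eval_get,
      Expr.eval_sub, e4, ea, hv, hI, hidx, hb (m - (k + 1)) (by omega), Store.setVar_var]
    have : 2 ^ (m - k) = 2 ^ (m - (k + 1)) * 2 := by
      rw [← pow_succ]; congr 1; omega
    norm_num [this, ← Nat.div_div_eq_div_mul]
    omega
  refine .then (reach_decodeProg s₂) fun s₃ f₃ q₃ => .assign_seq ?_
  have e0 : s₃.var 0 = n := by simpa [f₃.var 0 rfl, f₁.var 0 rfl] using f₂.var 0 rfl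
  have e1 : s₃.var 1 = s.var 1 := by simpa [f₃.var 1 rfl, f₁.var 1 rfl] using f₂.var 1 rfl
  have e2 : s₃.var 2 = s.var 2 := by simpa [f₃.var 2 rfl, f₁.var 2 rfl] using f₂.var 2 rfl
  have e3 : s₃.var 3 = s.var 3 := by simpa [f₃.var 3 rfl, f₁.var 3 rfl] using f₂.var 3 rfl
  have e15 : s₃.var 15 = 0 := by simpa [f₃.var 15 rfl] using f₂.var 15 rfl
  have ea : s₃.arr 1 = s.arr 1 := by simpa [f₃.arr 1 rfl, f₁.arr 1 rfl] using f₂.arr 1 rfl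
  have e6 : s₂.var 6 = seedRange n := by simpa [q₁.1] using f₂.var 6 rfl
  have e14 : s₂.var 14 = z := by simpa using q₂.2
  have e13 : s.var 3 * s.var 1 % (n + 1) = s.var 3 * s.var 1 := Nat.mod_eq_of_lt (by omega)
  rw [e6, e14] at q₃
  refine .then (reach_hashProg 1 15 16 _ (B := n) (by norm_num) (by norm_num) (by norm_num)
    (by simpa [e3, e1, e0, e13] using h3) (by simpa [e1] using h1) (by simpa [e2] using h2))
    fun s₄ f₄ q₄ => ?_
  simp [e0, e1, e2, e3, e13, e15, ea, q₃] at q₄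
  have g2 : s₄.var 2 = s.var 2 := by simpa [e2] using f₄.var 2 rfl
  refine .then (.loop (n := s.var 2) (fun k s' => s'.var 16 = s₄.var 16 / 2 ^ k ∧
    ∀ l < k, s'.arr 0 l = s₄.var 16 / 2 ^ l % 2) rfl ?_ ?_ ?_) fun s₅ f₅ q₅ => .assign ?_
  · intro s' hf
    simpa [g2] using hf.var 2 rfl
  · simp
  · intro k hk s' hf hv hI
    refine .seq (.store (.assign ?_))
    refine ⟨by simp [hI.1, Nat.div_div_eq_div_mul, pow_succ], fun l hl => ?_⟩
    rcases Nat.lt_succ_iff_lt_or_eq.1 hl with hlk | rfl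
    · simp [hv, hlk.ne, hI.2 l hlk]
    · simp [hv, hI.1]
  · refine ⟨by simpa [g2] using f₅.var 2 rfl, fun k hk => ?_⟩
    simpa [q₄, seedHash] using q₅.2.2 k hk

end RAM

/-! ### The generator -/

/-- Under the seed `z`, block `i` of the string `X` has the same hash value as the different
substring at position `j`. -/
def isBad (N z p q : ℕ) (X : ℕ → ℕ) (i j : ℕ) : Bool :=
  decide ((∃ k < p, X (i * p + k) ≠ X (j + k)) ∧
    seedHash N z (i * p) (fun k => X (i * p + k)) p q =
      seedHash N z (i * p) (fun k => X (j + k)) p q)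

/-- The largest number of bad pairs in a self-matching under the seed `z`. -/
def score (n p q : ℕ) (X : ℕ → ℕ) (z : ℕ) : ℕ :=
  longestChain p (isBad (seedRange n) z p q X) (n / p) n

theorem longestChain_le (p : ℕ) (g : ℕ → ℕ → Bool) (i j : ℕ) : longestChain p g i j ≤ i := by
  induction i generalizing j with
  | zero => exact le_rfl
  | succ i ih =>
    refine Finset.sup_le fun l _ => max_le ((ih l).trans i.le_succ) ?_
    split_ifs
    · exact Nat.succ_le_succ (ih _)
    · exact Nat.zero_le _

namespace RAM

/-- Register `25` receives `0` if and only if the `p` cells of array `0` that start at the positions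
in the registers `13` and `15` agree. -/
def diffProg : Prog :=
  .assign 25 0 ;;
  .loop 20 (.var 1) (.assign 25 (.var 25 +
    ((.get 0 (.var 13 + .var 20) - .get 0 (.var 15 + .var 20)) +
      (.get 0 (.var 15 + .var 20) - .get 0 (.var 13 + .var 20)))))

theorem reach_diffProg (s : Store) : Reach diffProg s (3 * s.var 1 + 3) fun s' =>
    s'.var 25 = 0 ↔ ∀ k < s.var 1, s.arr 0 (s.var 13 + k) = s.arr 0 (s.var 15 + k) := by
  refine .mono (N := s.var 1 * (1 + 2) + 2 + 1) (.assign_seq (.loop (n := s.var 1)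
    (fun k s' => s'.var 25 = 0 ↔ ∀ l < k, s.arr 0 (s.var 13 + l) = s.arr 0 (s.var 15 + l))
    rfl ?_ ?_ ?_)) (by omega) fun s' _ h => h.2
  · intro s' hf
    simpa using hf.var 1 rfl
  · simp
  · intro k hk s' hf hv hI
    have e13 : s'.var 13 = s.var 13 := by simpa using hf.var 13 rfl
    have e15 : s'.var 15 = s.var 15 := by simpa using hf.var 15 rfl
    have ea : s'.arr 0 = s.arr 0 := by simpa using hf.arr 0 rfl
    refine .assign ?_
    simp only [Nat.lt_succ_iff_lt_or_eq, or_imp, forall_and, forall_eq, ← hI]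
    simp [hv, e13, e15, ea]
    omega

/-- The entry of the dynamic program at block `i` and length `j` (in register `24`) that comes from
matching block `i` with the last `p` of the `j` positions. Register `19` is replaced by the maximum
of itself and this entry. Array `2` holds the previous row and register `18` the hash value of
block `i`. -/
def cellProg : Prog :=
  .ite (.var 24 + 1 - .var 1)
    (.assign 15 (.var 24 - .var 1) ;; hashProg 0 15 16 ;; diffProg ;;
      .ite ((.var 18 - .var 16) + (.var 16 - .var 18)) .skip
        (.ite (.var 25) (.assign 19 (.var 19 + (.get 2 (.var 15) + 1 - .var 19))) .skip))
    .skip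

theorem reach_cellProg (s : Store) {n N z i : ℕ} (h13 : s.var 13 = i * s.var 1)
    (h10 : s.var 10 = z % N) (h11 : s.var 11 = z / N % N) (h12 : s.var 12 = z / N / N)
    (h18 : s.var 18 = seedHash N z (i * s.var 1) (fun k => s.arr 0 (i * s.var 1 + k)) (s.var 1)
      (s.var 2))
    (hi : i * s.var 1 ≤ n) (hp : s.var 1 ≤ n) (hq : s.var 2 ≤ n) :
    Reach cellProg s (13 * n + 20) fun s' => s'.var 19 = max (s.var 19)
      (if s.var 1 ≤ s.var 24 ∧
        isBad N z (s.var 1) (s.var 2) (s.arr 0) i (s.var 24 - s.var 1) = true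
      then s.arr 2 (s.var 24 - s.var 1) + 1 else 0) := by
  refine .mono (N := 1 + 1 + 1 + (3 * s.var 1 + 3) + (10 * n + 9) + 1 + 1) (.ite (fun he => ?_)
    fun he => .mono (.skip ?_) (N := 1) (by omega) fun _ _ h => h) (by omega) fun _ _ h => h
  · have hpj : s.var 1 ≤ s.var 24 := by
      simp at he
      omega
    refine .assign_seq (.then (reach_hashProg 0 15 16 _ (B := n) (by norm_num) (by norm_num)
      (by norm_num) (by simpa [h13] using hi) (by simpa using hp) (by simpa using hq))
      fun s₁ f₁ q₁ => .then (.mono (reach_diffProg s₁) (by simp [f₁.var 1 rfl]) fun _ _ h => h)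
        fun s₂ f₂ q₂ => ?_)
    have d19 : s₂.var 19 = s.var 19 := by simpa [f₂.var 19 rfl] using f₁.var 19 rfl
    have d18 : s₂.var 18 = s.var 18 := by simpa [f₂.var 18 rfl] using f₁.var 18 rfl
    have c1 : s₁.var 1 = s.var 1 := by simpa using f₁.var 1 rfl
    have c13 : s₁.var 13 = i * s.var 1 := by simpa [h13] using f₁.var 13 rfl
    have c15 : s₁.var 15 = s.var 24 - s.var 1 := by simpa using f₁.var 15 rfl
    have d15 : s₂.var 15 = s.var 24 - s.var 1 := by simpa [c15] using f₂.var 15 rfl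
    have ca : s₁.arr 0 = s.arr 0 := by simpa using f₁.arr 0 rfl
    have da : s₂.arr 2 = s.arr 2 := by simpa [f₂.arr 2 rfl] using f₁.arr 2 rfl
    have d16 : s₂.var 16 = seedHash N z (i * s.var 1)
        (fun k => s.arr 0 (s.var 24 - s.var 1 + k)) (s.var 1) (s.var 2) := by
      rw [f₂.var 16 rfl, q₁]
      simp [h10, h11, h12, h13, seedHash]
    rw [c1, c13, c15, ca] at q₂
    have hbad : isBad N z (s.var 1) (s.var 2) (s.arr 0) i (s.var 24 - s.var 1) = true ↔
        s₂.var 25 ≠ 0 ∧ s₂.var 18 = s₂.var 16 := by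
      rw [isBad, decide_eq_true_iff, d18, h18, d16, Ne, q₂]
      push Not
      rfl
    refine .ite (fun hw => .mono (.skip ?_) (N := 1) (by omega) fun _ _ h => h)
      fun hw => .ite (fun hd => .assign ?_) fun hd => .skip ?_
    · rw [if_neg, d19, max_eq_left (Nat.zero_le _)]
      rw [hbad]
      simp only [Expr.eval_add, Expr.eval_sub, Expr.eval_var] at hw
      omega
    · simp only [Expr.eval_add, Expr.eval_sub, Expr.eval_var] at hw
      rw [if_pos ⟨hpj, hbad.2 ⟨hd, by omega⟩⟩]
      simp [d19, d15, da]
      omega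
    · rw [if_neg, d19, max_eq_left (Nat.zero_le _)]
      rw [hbad]
      exact fun h => h.2.1 hd
  · rw [if_neg, max_eq_left (Nat.zero_le _)]
    simp at he
    omega

/-- From row `i` of the dynamic program, in array `2`, to row `i + 1`. -/
def rowProg : Prog :=
  .assign 19 0 ;;
  .loop 24 (.var 0 + 1) (.assign 19 (.var 19 + (.get 2 (.var 24) - .var 19)) ;; cellProg ;;
    .store 3 (.var 24) (.var 19)) ;;
  .loop 24 (.var 0 + 1) (.store 2 (.var 24) (.get 3 (.var 24)))

theorem reach_rowProg (s : Store) {N z i : ℕ} (h13 : s.var 13 = i * s.var 1)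
    (h10 : s.var 10 = z % N) (h11 : s.var 11 = z / N % N) (h12 : s.var 12 = z / N / N)
    (h18 : s.var 18 = seedHash N z (i * s.var 1) (fun k => s.arr 0 (i * s.var 1 + k)) (s.var 1)
      (s.var 2))
    (hi : i * s.var 1 ≤ s.var 0) (hp : s.var 1 ≤ s.var 0) (hq : s.var 2 ≤ s.var 0)
    (hrow : ∀ j ≤ s.var 0, s.arr 2 j =
      longestChain (s.var 1) (isBad N z (s.var 1) (s.var 2) (s.arr 0)) i j) :
    Reach rowProg s ((s.var 0 + 1) * (13 * s.var 0 + 27) + 5) fun s' =>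
      ∀ j ≤ s.var 0, s'.arr 2 j =
        longestChain (s.var 1) (isBad N z (s.var 1) (s.var 2) (s.arr 0)) (i + 1) j := by
  set n := s.var 0 with hn
  set g := isBad N z (s.var 1) (s.var 2) (s.arr 0) with hg
  refine .mono (N := ((n + 1) * (1 + 2) + 2) + ((n + 1) * ((1 + (13 * n + 20) + 1) + 2) + 2) + 1)
    ?_ (by nlinarith) fun _ _ h => h
  refine .assign_seq (.then (.loop (n := n + 1) (fun k s' =>
      s'.var 19 = (Finset.range k).sup (fun l => max (longestChain (s.var 1) g i l)
        (if s.var 1 ≤ l ∧ g i (l - s.var 1) = true then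
          longestChain (s.var 1) g i (l - s.var 1) + 1 else 0)) ∧
      ∀ j < k, s'.arr 3 j = longestChain (s.var 1) g (i + 1) j)
    rfl ?_ ?_ ?_) fun s₁ f₁ q₁ => ?_)
  · intro s' hf
    simpa using hf.var 0 rfl
  · simp
  · intro k hk s' hf hv hI
    have e1 : s'.var 1 = s.var 1 := by simpa using hf.var 1 rfl
    have e2 : s'.var 2 = s.var 2 := by simpa using hf.var 2 rfl
    have e10 : s'.var 10 = s.var 10 := by simpa using hf.var 10 rfl
    have e11 : s'.var 11 = s.var 11 := by simpa using hf.var 11 rfl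
    have e12 : s'.var 12 = s.var 12 := by simpa using hf.var 12 rfl
    have e13 : s'.var 13 = s.var 13 := by simpa using hf.var 13 rfl
    have e18 : s'.var 18 = s.var 18 := by simpa using hf.var 18 rfl
    have ea : s'.arr 0 = s.arr 0 := by simpa using hf.arr 0 rfl
    have ea2 : s'.arr 2 = s.arr 2 := by simpa using hf.arr 2 rfl
    refine .assign_seq (.then (reach_cellProg _ (n := n) (N := N) (z := z) (i := i)
      (by simpa [e1, e13] using h13) (by simpa [e10] using h10) (by simpa [e11] using h11)
      (by simpa [e12] using h12) (by simpa [e18, e1, e2, ea] using h18) (by simpa [e1] using hi)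
      (by simpa [e1] using hp) (by simpa [e2] using hq)) fun s₁ f₁ q₁ => .store ?_)
    have hk2 := hrow k (by omega)
    have hk3 := hrow (k - s.var 1) (by omega)
    have e24 : s₁.var 24 = k := by simpa [hv] using f₁.var 24 rfl
    have ea3 : s₁.arr 3 = s'.arr 3 := by simpa using f₁.arr 3 rfl
    have hmax (a b : ℕ) : a + (b - a) = max a b := by omega
    have e19 : s₁.var 19 = (Finset.range (k + 1)).sup (fun l => max (longestChain (s.var 1) g i l)
        (if s.var 1 ≤ l ∧ g i (l - s.var 1) = true then
          longestChain (s.var 1) g i (l - s.var 1) + 1 else 0)) := by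
      rw [Finset.range_add_one, Finset.sup_insert, ← hI.1]
      simp only [Store.setVar_var, Store.setVar_arr, Expr.eval_add, Expr.eval_sub, Expr.eval_var,
        Expr.eval_get, hv, e1, e2, ea, ea2, hk2, hmax] at q₁
      rw [q₁]
      simp [← hg, hk3, max_comm, max_left_comm]
    refine ⟨by simpa using e19, fun j hj => ?_⟩
    rcases Nat.lt_succ_iff_lt_or_eq.1 hj with hjk | rfl
    · simp [e24, hjk.ne, ea3, hI.2 j hjk]
    · simp [e24, e19, longestChain]
  refine .mono (.loop (n := n + 1)
    (fun k s' => ∀ j < k, s'.arr 2 j = longestChain (s.var 1) g (i + 1) j) rfl ?_ ?_ ?_) le_rfl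
    fun s' _ h j hj => h.2 j (by omega)
  · intro s' hf
    simpa [f₁.var 0 rfl] using hf.var 0 rfl
  · simp
  · intro k hk s' hf hv hI
    have ea3 : s'.arr 3 = s₁.arr 3 := by simpa using hf.arr 3 rfl
    refine .store fun j hj => ?_
    rcases Nat.lt_succ_iff_lt_or_eq.1 hj with hjk | rfl
    · simp [hv, hjk.ne, hI j hjk]
    · simp [hv, ea3, q₁.2.2 j hk]

/-- The dynamic program for the seed in register `14`; cell `n` of array `2` receives its
score. -/
def scoreProg : Prog :=
  decodeProg ;; .loop 9 (.var 0 + 1) (.store 2 (.var 9) 0) ;; .assign 13 0 ;;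
  .loop 17 (.var 0 / .var 1) (hashProg 0 13 18 ;; rowProg ;; .assign 13 (.var 13 + .var 1))

theorem reach_scoreProg (s : Store) (h6 : s.var 6 = seedRange (s.var 0)) (hp : s.var 1 ≤ s.var 0)
    (hq : s.var 2 ≤ s.var 0) :
    Reach scoreProg s (50 * (s.var 0 + 1) ^ 3) fun s' =>
      s'.arr 2 (s.var 0) = score (s.var 0) (s.var 1) (s.var 2) (s.arr 0) (s.var 14) := by
  set n := s.var 0 with hn
  set p := s.var 1 with hp'
  set g := isBad (seedRange n) (s.var 14) p (s.var 2) (s.arr 0) with hg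
  have hdiv : n / p ≤ n := Nat.div_le_self n p
  refine .mono (N := ((n / p) * ((1 + ((n + 1) * (13 * n + 27) + 5) + (10 * n + 9)) + 2) + 2) + 1 +
    ((n + 1) * (1 + 2) + 2) + 3) ?_ ?_ fun _ _ h => h
  · refine .then (reach_decodeProg s) fun s₁ f₁ q₁ => .then
      (.loop (n := n + 1) (fun k s' => ∀ j < k, s'.arr 2 j = 0) rfl ?_ ?_ ?_)
      fun s₂ f₂ q₂ => .assign_seq ?_
    · intro s' hf
      simpa [f₁.var 0 rfl] using hf.var 0 rfl
    · simp
    · intro k hk s' hf hv hI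
      refine .store fun j hj => ?_
      rcases Nat.lt_succ_iff_lt_or_eq.1 hj with hjk | rfl
      · simp [hv, hjk.ne, hI j hjk]
      · simp [hv]
    have e0 : s₂.var 0 = n := by simpa [f₁.var 0 rfl] using f₂.var 0 rfl
    have e1 : s₂.var 1 = p := by simpa [f₁.var 1 rfl] using f₂.var 1 rfl
    have e2 : s₂.var 2 = s.var 2 := by simpa [f₁.var 2 rfl] using f₂.var 2 rfl
    have e10 := f₂.var 10 rfl
    have e11 := f₂.var 11 rfl
    have e12 := f₂.var 12 rfl
    rw [q₁.1, h6] at e10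
    rw [q₁.2.1, h6] at e11
    rw [q₁.2.2, h6] at e12
    have ea : s₂.arr 0 = s.arr 0 := by simpa [f₁.arr 0 rfl] using f₂.arr 0 rfl
    refine .mono (.loop (n := n / p) (fun k s' => s'.var 13 = k * p ∧
      ∀ j ≤ n, s'.arr 2 j = longestChain p g k j) rfl ?_ ?_ ?_) le_rfl
      fun s' _ h => h.2.2 n le_rfl
    · intro s' hf
      have g0 : s'.var 0 = n := by simpa [e0] using hf.var 0 rfl
      have g1 : s'.var 1 = p := by simpa [e1] using hf.var 1 rfl
      simp [g0, g1]
    · simp only [Store.setVar_var, Expr.eval_ofNat, Store.setVar_arr]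
      exact ⟨by simp, fun j hj => by simpa [longestChain] using q₂.2 j (by omega)⟩
    · intro k hk s' hf hv hI
      have hkp : k * p ≤ n := (Nat.mul_le_mul_right p hk.le).trans (Nat.div_mul_le_self n p)
      have g0 : s'.var 0 = n := by simpa [e0] using hf.var 0 rfl
      have g1 : s'.var 1 = p := by simpa [e1] using hf.var 1 rfl
      have g2 : s'.var 2 = s.var 2 := by simpa [e2] using hf.var 2 rfl
      have g10 := hf.var 10 rfl
      have g11 := hf.var 11 rfl
      have g12 := hf.var 12 rfl
      simp only [Store.setVar_var] at g10 g11 g12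
      norm_num [e10, e11, e12] at g10 g11 g12
      have ga : s'.arr 0 = s.arr 0 := by simpa [ea] using hf.arr 0 rfl
      refine .then (reach_hashProg 0 13 18 s' (B := n) (by norm_num) (by norm_num) (by norm_num)
        (by rw [hI.1]; exact hkp) (by rw [g1]; exact hp) (by rw [g2]; exact hq))
        fun s₃ f₃ q₃ => ?_
      have i0 : s₃.var 0 = n := by rw [f₃.var 0 rfl, g0]
      have i1 : s₃.var 1 = p := by rw [f₃.var 1 rfl, g1]
      have i2 : s₃.var 2 = s.var 2 := by rw [f₃.var 2 rfl, g2]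
      have i13 : s₃.var 13 = k * p := by rw [f₃.var 13 rfl, hI.1]
      have ia : s₃.arr 0 = s.arr 0 := by rw [f₃.arr 0 rfl, ga]
      have hrow := reach_rowProg s₃ (N := seedRange n) (z := s.var 14) (i := k)
        (by rw [i13, i1]) (by rw [f₃.var 10 rfl, g10]) (by rw [f₃.var 11 rfl, g11])
        (by rw [f₃.var 12 rfl, g12])
        (by rw [q₃, i1, i2, ia, hI.1, g10, g11, g12, g1, g2, ga]; rfl)
        (by rw [i0, i1]; exact hkp) (by rw [i0, i1]; exact hp) (by rw [i0, i2]; exact hq)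
        (by
          rw [i0, i1, i2, ia, f₃.arr 2 rfl]
          exact hI.2)
      rw [i0, i1, i2, ia] at hrow
      refine .then hrow fun s₄ f₄ q₄ => .assign ⟨?_, ?_⟩
      · simp [f₄.var 13 rfl, f₄.var 1 rfl, i1, i13, add_mul]
      · simpa using q₄
  · have h1 : (n / p) * ((1 + ((n + 1) * (13 * n + 27) + 5) + (10 * n + 9)) + 2) ≤
        n * ((1 + ((n + 1) * (13 * n + 27) + 5) + (10 * n + 9)) + 2) := Nat.mul_le_mul_right _ hdiv
    nlinarith [Nat.zero_le (n ^ 3), Nat.zero_le (n ^ 2)]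

/-- The generator: it tries all seeds, keeps one of least score in register `31`, and outputs its
binary digits. Register `30` holds the least score so far; its initial value `n + 1` exceeds all
scores. -/
def genProg : Prog :=
  setupProg ;; .assign 30 (.var 0 + 1) ;; .assign 31 0 ;;
  .loop 14 (.var 7) (scoreProg ;; .ite (.var 30 - .get 2 (.var 0))
    (.assign 30 (.get 2 (.var 0)) ;; .assign 31 (.var 14)) .skip) ;;
  .loop 9 (.var 8) (.store 0 (.var 9) (.var 31 % 2) ;; .assign 31 (.var 31 / 2)) ;;
  .assign 0 (.var 8)

theorem reach_genProg (s : Store) (hp : s.var 1 ≤ s.var 0) (hq : s.var 2 ≤ s.var 0) :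
    Reach genProg s (2 ^ (66 * Nat.clog 2 (s.var 0)) * (60 * (s.var 0 + 1) ^ 3) +
        300 * (s.var 0 + 1)) fun s' =>
      ∃ z < 2 ^ (66 * Nat.clog 2 (s.var 0)),
        (∀ z' < 2 ^ (66 * Nat.clog 2 (s.var 0)),
          score (s.var 0) (s.var 1) (s.var 2) (s.arr 0) z ≤
            score (s.var 0) (s.var 1) (s.var 2) (s.arr 0) z') ∧
        s'.var 0 = 66 * Nat.clog 2 (s.var 0) ∧
        ∀ k < 66 * Nat.clog 2 (s.var 0), s'.arr 0 k = z / 2 ^ k % 2 := by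
  set n := s.var 0 with hn
  set m := 66 * Nat.clog 2 n with hm
  set σ := score n (s.var 1) (s.var 2) (s.arr 0) with hσ
  have hln : Nat.clog 2 n ≤ n := Nat.clog_le_of_le_pow Nat.lt_two_pow_self.le
  refine .mono (N := 1 + (m * (1 + 1 + 2) + 2) +
    (2 ^ m * ((1 + 1 + 1 + 50 * (n + 1) ^ 3) + 2) + 2) + 1 + 1 + (7 * n + 6)) ?_ ?_ fun _ _ h => h
  · refine .then (reach_setupProg s) fun s₁ f₁ q₁ => .assign_seq (.assign_seq (.then
      (.loop (n := 2 ^ m) (fun k s' => (∀ z' < k, s'.var 30 ≤ σ z') ∧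
        (s'.var 31 < k ∧ s'.var 30 = σ (s'.var 31) ∨ s'.var 30 = n + 1)) rfl ?_ ?_ ?_)
      fun s₂ f₂ q₂ => ?_))
    · intro s' hf
      simpa [q₁.2.1] using hf.var 7 rfl
    · simp [f₁.var 0 rfl, hn]
    · intro k hk s' hf hv hI
      have e0 : s'.var 0 = n := by simpa [f₁.var 0 rfl] using hf.var 0 rfl
      have e1 : s'.var 1 = s.var 1 := by simpa [f₁.var 1 rfl] using hf.var 1 rfl
      have e2 : s'.var 2 = s.var 2 := by simpa [f₁.var 2 rfl] using hf.var 2 rfl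
      have e6 : s'.var 6 = seedRange n := by simpa [q₁.1] using hf.var 6 rfl
      have ea : s'.arr 0 = s.arr 0 := by simpa [f₁.arr 0 rfl] using hf.arr 0 rfl
      have hsc := reach_scoreProg s' (by rw [e6, e0]) (by rw [e1, e0]; exact hp)
        (by rw [e2, e0]; exact hq)
      rw [e0, e1, e2, ea, hv, ← hσ] at hsc
      refine .then hsc fun s₂ f₂ q₂ => ?_
      have g0 : s₂.var 0 = n := by rw [f₂.var 0 rfl, e0]
      have g14 : s₂.var 14 = k := by rw [f₂.var 14 rfl, hv]
      rw [← f₂.var 30 rfl, ← f₂.var 31 rfl] at hI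
      refine .ite (fun he => .assign_seq (.assign ?_)) fun he => .mono (.skip ?_) (N := 1)
        (by omega) fun _ _ h => h
      · simp only [Expr.eval_sub, Expr.eval_var, Expr.eval_get, g0, q₂] at he
        simp only [Store.setVar_var, Expr.eval_var, Expr.eval_get, g0, q₂, g14]
        norm_num
        intro z' hz'
        rcases Nat.le_iff_lt_or_eq.1 hz' with h | rfl
        · have := hI.1 z' h
          omega
        · exact le_rfl
      · simp only [Expr.eval_sub, Expr.eval_var, Expr.eval_get, g0, q₂] at he
        simp only [Store.setVar_var]
        norm_num
        refine ⟨fun z' hz' => ?_, ?_⟩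
        · rcases Nat.le_iff_lt_or_eq.1 hz' with h | rfl
          · exact hI.1 z' h
          · omega
        · rcases hI.2 with h | h
          · exact .inl ⟨by omega, h.2⟩
          · exact .inr h
    have e31 : s₂.var 31 < 2 ^ m ∧ s₂.var 30 = σ (s₂.var 31) := by
      rcases q₂.2.2 with h | h
      · exact h
      · have h0 := q₂.2.1 0 (by positivity)
        have h1 : σ 0 ≤ n / s.var 1 := longestChain_le _ _ _ _
        have h2 : n / s.var 1 ≤ n := Nat.div_le_self _ _
        omega
    have e8 : s₂.var 8 = m := by simpa [q₁.2.2] using f₂.var 8 rfl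
    refine .then (.loop (n := m) (fun k s' => s'.var 31 = s₂.var 31 / 2 ^ k ∧
      ∀ l < k, s'.arr 0 l = s₂.var 31 / 2 ^ l % 2) rfl ?_ ?_ ?_) fun s₃ f₃ q₃ => .assign ?_
    · intro s' hf
      simpa [e8] using hf.var 8 rfl
    · simp
    · intro k hk s' hf hv hI
      refine .seq (.store (.assign ?_))
      refine ⟨by simp [hI.1, Nat.div_div_eq_div_mul, pow_succ], fun l hl => ?_⟩
      rcases Nat.lt_succ_iff_lt_or_eq.1 hl with hlk | rfl
      · simp [hv, hlk.ne, hI.2 l hlk]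
      · simp [hv, hI.1]
    · refine ⟨s₂.var 31, e31.1, fun z' hz' => ?_, by simpa [e8] using f₃.var 8 rfl,
        fun k hk => by simpa using q₃.2.2 k hk⟩
      rw [← e31.2]
      exact q₂.2.1 z' hz'
  · have h1 : 1 ≤ (n + 1) ^ 3 := Nat.one_le_pow _ _ (Nat.succ_pos n)
    have h2 : 2 ^ m * ((1 + 1 + 1 + 50 * (n + 1) ^ 3) + 2) ≤ 2 ^ m * (60 * (n + 1) ^ 3) :=
      Nat.mul_le_mul_left _ (by omega)
    omega

end RAM

/-! ### Monotone chains -/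

/-- `w` is a monotone matching of the first `I` blocks with disjoint substrings of length `p` inside
the first `J` positions, all of whose pairs satisfy `g`. -/
structure IsBlockChain (p : ℕ) (g : ℕ → ℕ → Bool) (I J : ℕ) (w : List (ℕ × ℕ)) : Prop where
  pairwise : w.Pairwise fun a b => a.1 < b.1 ∧ a.2 + p ≤ b.2
  mem : ∀ a ∈ w, a.1 < I ∧ a.2 + p ≤ J ∧ g a.1 a.2 = true

theorem IsBlockChain.length_le {p : ℕ} {g : ℕ → ℕ → Bool} {I J : ℕ} {w : List (ℕ × ℕ)}
    (h : IsBlockChain p g I J w) : w.length ≤ longestChain p g I J := by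
  induction I generalizing J w with
  | zero =>
    cases w with
    | nil => exact le_rfl
    | cons a w => exact absurd (h.mem a (by simp)).1 (Nat.not_lt_zero _)
  | succ I ih =>
    have key (l : ℕ) (hl : l ≤ J) := Finset.le_sup (f := fun l => max (longestChain p g I l)
      (if p ≤ l ∧ g I (l - p) = true then longestChain p g I (l - p) + 1 else 0))
      (Finset.mem_range_succ_iff.2 hl)
    rcases w.eq_nil_or_concat with rfl | ⟨w, a, rfl⟩
    · exact Nat.zero_le _
    · rw [List.concat_eq_append] at h ⊢
      have hpw := List.pairwise_append.1 h.pairwise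
      have hwa : ∀ b ∈ w, b.1 < a.1 ∧ b.2 + p ≤ a.2 := fun b hb => hpw.2.2 b hb a (by simp)
      have ha := h.mem a (by simp)
      have hw : ∀ b ∈ w, g b.1 b.2 = true := fun b hb => (h.mem b (by simp [hb])).2.2
      rcases Nat.lt_succ_iff_lt_or_eq.1 ha.1 with hlt | heq
      · refine (ih (J := J) ⟨h.pairwise, fun b hb => ?_⟩).trans
          ((le_max_left _ _).trans (key J le_rfl))
        refine ⟨?_, (h.mem b hb).2⟩
        rcases List.mem_append.1 hb with hb | hb
        · exact (hwa b hb).1.trans hlt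
        · simpa [List.mem_singleton.1 hb] using hlt
      · have h₁ : w.length ≤ longestChain p g I a.2 :=
          ih ⟨hpw.1, fun b hb => ⟨heq ▸ (hwa b hb).1, (hwa b hb).2, hw b hb⟩⟩
        refine le_trans ?_ ((le_max_right _ _).trans (key (a.2 + p) ha.2.1))
        rw [if_pos ⟨Nat.le_add_left _ _, by simpa [← heq] using ha.2.2⟩]
        simpa using h₁

theorem exists_isBlockChain_length_eq (p : ℕ) (g : ℕ → ℕ → Bool) (I J : ℕ) :
    ∃ w, IsBlockChain p g I J w ∧ w.length = longestChain p g I J := by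
  induction I generalizing J with
  | zero => exact ⟨[], ⟨.nil, by simp⟩, rfl⟩
  | succ I ih =>
    obtain ⟨l, hl, hsup⟩ := Finset.exists_mem_eq_sup (Finset.range (J + 1)) ⟨0, by simp⟩
      (fun l => max (longestChain p g I l)
        (if p ≤ l ∧ g I (l - p) = true then longestChain p g I (l - p) + 1 else 0))
    have hlJ := Finset.mem_range_succ_iff.1 hl
    have hlen : longestChain p g (I + 1) J = _ := hsup
    obtain ⟨w, hw, hwl⟩ := ih l
    have hw' : IsBlockChain p g (I + 1) J w := ⟨hw.pairwise, fun a ha =>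
      ⟨(hw.mem a ha).1.trans (Nat.lt_succ_self I), (hw.mem a ha).2.1.trans hlJ,
        (hw.mem a ha).2.2⟩⟩
    rw [hlen]
    split_ifs with hg
    · rcases le_total (longestChain p g I (l - p) + 1) (longestChain p g I l) with hle | hle
      · exact ⟨w, hw', by rw [max_eq_left hle, hwl]⟩
      · obtain ⟨v, hv, hvl⟩ := ih (l - p)
        refine ⟨v ++ [(I, l - p)], ⟨List.pairwise_append.2 ⟨hv.pairwise, by simp, ?_⟩, ?_⟩, ?_⟩
        · intro a ha b hb
          rw [List.mem_singleton.1 hb]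
          exact ⟨(hv.mem a ha).1, (hv.mem a ha).2.1⟩
        · intro a ha
          rcases List.mem_append.1 ha with ha | ha
          · have := hv.mem a ha
            exact ⟨this.1.trans (Nat.lt_succ_self I), by omega, this.2.2⟩
          · rw [List.mem_singleton.1 ha]
            exact ⟨Nat.lt_succ_self I, by omega, hg.2⟩
        · rw [max_eq_right hle, List.length_append, hvl]
          rfl
    · exact ⟨w, hw', by rw [max_eq_left (Nat.zero_le _), hwl]⟩

/-! ### Simultaneous collisions of linear forms -/

theorem addChar_map_sum {A M ι : Type*} [AddCommMonoid A] [CommMonoid M] (ψ : AddChar A M)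
    (t : Finset ι) (f : ι → A) : ψ (∑ i ∈ t, f i) = ∏ i ∈ t, ψ (f i) := by
  classical
  induction t using Finset.induction_on with
  | empty => simp
  | insert a t ha ih => rw [Finset.sum_insert ha, Finset.prod_insert ha, AddChar.map_add_eq_mul, ih]

open ZMod in
/-- Orthogonality of characters: the second moment of a sum of characters counts coincidences among
the frequencies. -/
theorem sum_normSq_sum_stdAddChar {P : ℕ} [NeZero P] {τ : Type*} [Fintype τ] (v : τ → ZMod P) :
    ∑ y : ZMod P, ‖∑ s, stdAddChar (y * v s)‖ ^ 2 =
      P * (Finset.univ.filter fun t : τ × τ => v t.1 = v t.2).card := by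
  have h (y : ZMod P) : ((‖∑ s, stdAddChar (y * v s)‖ ^ 2 : ℝ) : ℂ) =
      ∑ t : τ × τ, stdAddChar (y * (v t.1 - v t.2)) := by
    rw [Complex.ofReal_pow, ← Complex.mul_conj', map_sum, Finset.sum_mul_sum,
      Fintype.sum_prod_type]
    refine Finset.sum_congr rfl fun s _ => Finset.sum_congr rfl fun s' _ => ?_
    rw [← AddChar.map_neg_eq_conj, ← AddChar.map_add_eq_mul]
    congr 1
    ring
  have h' : ((∑ y : ZMod P, ‖∑ s, stdAddChar (y * v s)‖ ^ 2 : ℝ) : ℂ) =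
      ((P * (Finset.univ.filter fun t : τ × τ => v t.1 = v t.2).card : ℝ) : ℂ) := by
    rw [Complex.ofReal_sum, Finset.sum_congr rfl fun y _ => h y, Finset.sum_comm]
    rw [Finset.sum_congr rfl fun t _ =>
      AddChar.sum_mulShift (v t.1 - v t.2) (isPrimitive_stdAddChar P)]
    simp only [sub_eq_zero, ZMod.card]
    simp [apply_ite (Nat.cast : ℕ → ℂ), ← Finset.sum_filter, mul_comm]
  exact_mod_cast h'

open ZMod in
/-- If `c` is close to `0` on the circle `ℤ / P`, then the first `S` multiples of `c` do not leave
the arc on which the cosine is at least `1 / 2`. -/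
theorem half_le_norm_sum_stdAddChar {P : ℕ} [NeZero P] {S : ℕ} {δ : ℤ}
    (hδ : 6 * S * |δ| ≤ P) :
    (S / 2 : ℝ) ≤ ‖∑ s : Fin S, stdAddChar (((s : ℕ) : ZMod P) * (δ : ZMod P))‖ := by
  refine le_trans ?_ (Complex.abs_re_le_norm _)
  refine le_trans ?_ (le_abs_self _)
  rw [Complex.re_sum]
  have hP : (0 : ℝ) < P := by exact_mod_cast Nat.pos_of_ne_zero (NeZero.ne P)
  have h (s : Fin S) : (1 / 2 : ℝ) ≤ (stdAddChar (((s : ℕ) : ZMod P) * (δ : ZMod P))).re := by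
    have e : (((s : ℕ) : ZMod P) * (δ : ZMod P)) = (((s : ℕ) * δ : ℤ) : ZMod P) := by push_cast; rfl
    rw [e, stdAddChar_coe]
    have e' : 2 * Real.pi * Complex.I * (((s : ℕ) * δ : ℤ) : ℂ) / P =
        ((2 * Real.pi * ((s : ℕ) * δ) / P : ℝ) : ℂ) * Complex.I := by
      push_cast; ring
    rw [e', Complex.exp_ofReal_mul_I_re, ← Real.cos_abs, ← Real.cos_pi_div_three]
    have hs : (6 * (s : ℕ) * |δ| : ℝ) ≤ P := by
      have h1 : (6 * S * |δ| : ℝ) ≤ P := by exact_mod_cast hδ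
      have h2 : ((s : ℕ) : ℝ) ≤ S := by exact_mod_cast s.2.le
      have h3 : (0 : ℝ) ≤ |(δ : ℝ)| := abs_nonneg _
      push_cast at h1 ⊢
      nlinarith
    apply Real.cos_le_cos_of_nonneg_of_le_pi (abs_nonneg _) (by linarith [Real.pi_pos])
    rw [abs_div, abs_mul (2 * Real.pi), abs_mul ((s : ℕ) : ℝ), abs_of_pos hP,
      abs_of_pos (by positivity : 0 < 2 * Real.pi), Nat.abs_cast, div_le_iff₀ hP]
    push_cast at hs
    nlinarith [Real.pi_pos]
  calc (S / 2 : ℝ) = ∑ s : Fin S, (1 / 2 : ℝ) := by simp; ring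
    _ ≤ _ := Finset.sum_le_sum fun s _ => h s

open ZMod Polynomial in
/-- For linearly independent polynomials `D l` of degree less than `n` and random `x, y`, the
probability that all values `y * D l x` are close to `0` is not much larger than if these values
were independent. The characteristic function of an arc is dominated by a Fejér kernel, whose
expansion into characters has nonnegative coefficients, and a nontrivial character contributes only
for the fewer than `n` roots `x` of some nonzero combination of the `D l`. -/
theorem card_mul_pow_le_of_close {P : ℕ} [Fact P.Prime] {ι : Type*} [Fintype ι] [DecidableEq ι]
    {D : ι → (ZMod P)[X]} (hD : LinearIndependent (ZMod P) D) {n S : ℕ}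
    (hdeg : ∀ l, (D l).degree < n) (hS : 0 < S) (hSP : S ≤ P) {A : Finset (ZMod P × ZMod P)}
    (hA : ∀ a ∈ A, ∀ l, ∃ δ : ℤ, 6 * S * |δ| ≤ P ∧ (δ : ZMod P) = a.2 * (D l).eval a.1) :
    A.card * S ^ Fintype.card ι ≤
      4 ^ Fintype.card ι * (P * (P + S ^ Fintype.card ι * n)) := by
  set k := Fintype.card ι with hk
  let v (x : ZMod P) (s : ι → Fin S) : ZMod P := ∑ l, ((s l : ℕ) : ZMod P) * (D l).eval x
  have hinj {s t : Fin S} (h : ((s : ℕ) : ZMod P) = ((t : ℕ) : ZMod P)) : s = t := by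
    rw [ZMod.natCast_eq_natCast_iff, Nat.ModEq, Nat.mod_eq_of_lt (s.2.trans_le hSP),
      Nat.mod_eq_of_lt (t.2.trans_le hSP)] at h
    exact Fin.ext h
  have hroots (t : (ι → Fin S) × (ι → Fin S)) :
      (Finset.univ.filter fun x => v x t.1 = v x t.2).card ≤ if t.1 = t.2 then P else n := by
    split_ifs with ht
    · exact (Finset.card_le_univ _).trans (ZMod.card P).le
    · set G : (ZMod P)[X] := ∑ l, (((t.1 l : ℕ) : ZMod P) - ((t.2 l : ℕ) : ZMod P)) • D l with hG
      have hG0 : G ≠ 0 := by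
        intro h0
        exact ht (funext fun l => hinj (sub_eq_zero.1 (Fintype.linearIndependent_iff.1 hD _ h0 l)))
      have hGdeg : G.degree < n := by
        refine lt_of_le_of_lt (degree_sum_le _ _) ((Finset.sup_lt_iff ?_).2 fun l _ => ?_)
        · exact WithBot.bot_lt_coe n
        · exact (degree_smul_le _ _).trans_lt (hdeg l)
      have hsub : (Finset.univ.filter fun x => v x t.1 = v x t.2) ⊆ G.roots.toFinset := by
        intro x hx
        rw [Multiset.mem_toFinset, mem_roots hG0, IsRoot.def, hG, eval_finsetSum]
        simp only [eval_smul, smul_eq_mul, sub_mul, Finset.sum_sub_distrib]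
        exact sub_eq_zero.2 (Finset.mem_filter.1 hx).2
      refine (Finset.card_le_card hsub).trans ((Multiset.toFinset_card_le _).trans
        ((card_roots' G).trans ?_))
      exact ((natDegree_lt_iff_degree_lt hG0).2 hGdeg).le
  -- the second moment, summed over `x`: pairs with `t.1 = t.2` give the main term
  have hcount : ∑ x : ZMod P, (Finset.univ.filter fun t : (ι → Fin S) × (ι → Fin S) =>
      v x t.1 = v x t.2).card ≤ S ^ k * P + S ^ k * S ^ k * n := by
    have hswap := Finset.sum_card_bipartiteAbove_eq_sum_card_bipartiteBelow
      (s := (Finset.univ : Finset (ZMod P)))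
      (t := (Finset.univ : Finset ((ι → Fin S) × (ι → Fin S)))) fun x t => v x t.1 = v x t.2
    refine hswap.le.trans ?_
    refine (Finset.sum_le_sum fun t _ => hroots t).trans ?_
    rw [Fintype.sum_prod_type]
    have hcard : Fintype.card (ι → Fin S) = S ^ k := by simp [hk]
    calc ∑ s : ι → Fin S, ∑ s' : ι → Fin S, (if s = s' then P else n)
        ≤ ∑ s : ι → Fin S, ∑ s' : ι → Fin S, ((if s = s' then P else 0) + n) :=
          Finset.sum_le_sum fun s _ => Finset.sum_le_sum fun s' _ => by split_ifs <;> omega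
      _ = _ := by
          simp only [Finset.sum_add_distrib, Finset.sum_ite_eq, Finset.mem_univ, if_true,
            Finset.sum_const, Finset.card_univ, smul_eq_mul, hcard]
          ring
  have hprod (x y : ZMod P) : ∑ s : ι → Fin S, stdAddChar (y * v x s) =
      ∏ l, ∑ s : Fin S, stdAddChar (((s : ℕ) : ZMod P) * (y * (D l).eval x)) := by
    rw [Finset.prod_univ_sum, Fintype.piFinset_univ]
    refine Finset.sum_congr rfl fun s _ => ?_
    rw [← addChar_map_sum, Finset.mul_sum]
    congr 1
    exact Finset.sum_congr rfl fun l _ => by ring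
  have hlow : ∀ a ∈ A, ((S : ℝ) ^ 2 / 4) ^ k ≤
      ‖∑ s : ι → Fin S, stdAddChar (a.2 * v a.1 s)‖ ^ 2 := by
    intro a ha
    rw [hprod, norm_prod, ← Finset.prod_pow, hk, ← Finset.card_univ, ← Finset.prod_const]
    refine Finset.prod_le_prod (fun _ _ => by positivity) fun l _ => ?_
    obtain ⟨δ, hδ, he⟩ := hA a ha l
    have := half_le_norm_sum_stdAddChar hδ
    rw [he] at this
    calc (S : ℝ) ^ 2 / 4 = (S / 2 : ℝ) ^ 2 := by ring
      _ ≤ _ := by gcongr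
  have hreal : (A.card : ℝ) * ((S : ℝ) ^ 2 / 4) ^ k ≤
      P * (S ^ k * P + S ^ k * S ^ k * n) := by
    calc (A.card : ℝ) * ((S : ℝ) ^ 2 / 4) ^ k = ∑ a ∈ A, ((S : ℝ) ^ 2 / 4) ^ k := by simp
      _ ≤ ∑ a ∈ A, ‖∑ s : ι → Fin S, stdAddChar (a.2 * v a.1 s)‖ ^ 2 := Finset.sum_le_sum hlow
      _ ≤ ∑ a : ZMod P × ZMod P, ‖∑ s : ι → Fin S, stdAddChar (a.2 * v a.1 s)‖ ^ 2 :=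
        Finset.sum_le_univ_sum_of_nonneg fun a => by positivity
      _ = ∑ x : ZMod P, (P : ℝ) * (Finset.univ.filter fun t : (ι → Fin S) × (ι → Fin S) =>
          v x t.1 = v x t.2).card := by
        rw [Fintype.sum_prod_type]
        exact Finset.sum_congr rfl fun x _ => sum_normSq_sum_stdAddChar (v x)
      _ ≤ _ := by
        rw [← Finset.mul_sum]
        gcongr
        exact_mod_cast hcount
  have hSk : (0 : ℝ) < (S : ℝ) ^ k := by positivity
  have h4 : (0 : ℝ) < (4 : ℝ) ^ k := by positivity
  rw [div_pow, ← pow_mul, mul_comm 2 k, pow_mul, sq, mul_div_assoc', div_le_iff₀ h4] at hreal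
  have : (A.card : ℝ) * S ^ k ≤ 4 ^ k * (P * (P + S ^ k * n)) := by
    refine le_of_mul_le_mul_right ?_ hSk
    linarith
  exact_mod_cast this

/-! ### Collisions under a random seed -/

open Polynomial in
/-- The formal difference of the linear forms of block `i` and of the substring at `j`. -/
noncomputable def diffPoly (P : ℕ) (p : ℕ) (X : ℕ → ℕ) (i j : ℕ) : (ZMod P)[X] :=
  ∑ k ∈ Finset.range p,
    C ((X (i * p + k) : ZMod P) - (X (j + k) : ZMod P)) * Polynomial.X ^ (i * p + k)

open Polynomial in
theorem diffPoly_degree_lt (P : ℕ) {n p : ℕ} (X : ℕ → ℕ) {i : ℕ} (j : ℕ) (h : i * p + p ≤ n) :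
    (diffPoly P p X i j).degree < n := by
  refine lt_of_le_of_lt (degree_sum_le _ _)
    ((Finset.sup_lt_iff (WithBot.bot_lt_coe n)).2 fun k hk => ?_)
  refine (degree_C_mul_X_pow_le _ _).trans_lt ?_
  have := Finset.mem_range.1 hk
  exact Nat.cast_lt.2 (by omega : i * p + k < n)

open Polynomial in
theorem diffPoly_coeff (P p : ℕ) (X : ℕ → ℕ) (i j i' : ℕ) {k : ℕ} (hk : k < p) :
    (diffPoly P p X i j).coeff (i' * p + k) =
      if i' = i then (X (i * p + k) : ZMod P) - (X (j + k) : ZMod P) else 0 := by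
  rw [diffPoly, finsetSum_coeff]
  simp only [coeff_C_mul_X_pow]
  have key : ∀ l ∈ Finset.range p, (i' * p + k = i * p + l ↔ i' = i ∧ k = l) := by
    intro l hl
    have hl := Finset.mem_range.1 hl
    refine ⟨fun h => ?_, fun h => by rw [h.1, h.2]⟩
    have h1 : i' = i := by
      have := congrArg (· / p) h
      simpa [mul_comm _ p, Nat.mul_add_div (Nat.zero_lt_of_lt hk), Nat.div_eq_of_lt hk,
        Nat.div_eq_of_lt hl] using this
    subst h1
    exact ⟨rfl, by omega⟩
  rw [Finset.sum_congr rfl fun l hl => if_congr (key l hl) rfl rfl]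
  split_ifs with h
  · simp [h, hk]
  · simp [h]

open Polynomial in
theorem diffPoly_eval (P p : ℕ) (X : ℕ → ℕ) (i j : ℕ) (x : ZMod P) :
    (diffPoly P p X i j).eval x = ∑ k ∈ Finset.range p,
      ((X (i * p + k) : ZMod P) - (X (j + k) : ZMod P)) * x ^ (i * p + k) := by
  simp [diffPoly, eval_finsetSum]

/-- The polynomials `diffPoly` of different blocks live in disjoint ranges of degrees. -/
theorem linearIndependent_diffPoly {P : ℕ} [Fact P.Prime] {p : ℕ} {X : ℕ → ℕ} (hX : ∀ t, X t ≤ 1)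
    {ι : Type*} [Fintype ι] {f g : ι → ℕ} (hf : Function.Injective f)
    (hd : ∀ l, ∃ k < p, X (f l * p + k) ≠ X (g l + k)) :
    LinearIndependent (ZMod P) fun l => diffPoly P p X (f l) (g l) := by
  classical
  rw [Fintype.linearIndependent_iff]
  intro c hc l
  obtain ⟨k, hk, hne⟩ := hd l
  have h := congrArg (fun G => G.coeff (f l * p + k)) hc
  simp only [Polynomial.finsetSum_coeff, Polynomial.coeff_smul, smul_eq_mul,
    diffPoly_coeff P p X _ _ _ hk, hf.eq_iff, mul_ite, mul_zero, Finset.sum_ite_eq,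
    Finset.mem_univ, if_true, Polynomial.coeff_zero] at h
  refine (mul_eq_zero.1 h).resolve_right ?_
  have h1 := hX (f l * p + k)
  have h2 := hX (g l + k)
  rcases Nat.le_one_iff_eq_zero_or_eq_one.1 h1 with h1 | h1 <;>
    rcases Nat.le_one_iff_eq_zero_or_eq_one.1 h2 with h2 | h2 <;> simp_all

/-- Equal hash values force the difference of the two linear forms to be close to `0` modulo
`P`. -/
theorem exists_close_of_hashNat_eq {P x y e p q : ℕ} (hP : 0 < P) {a b : ℕ → ℕ}
    (h : hashNat P x y e a p q = hashNat P x y e b p q) :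
    ∃ δ : ℤ, 2 ^ q * |δ| ≤ P ∧ (δ : ZMod P) =
      y * ∑ k ∈ Finset.range p, ((a k : ZMod P) - (b k : ZMod P)) * x ^ (e + k) := by
  refine ⟨(hashMod P x y e a p : ℤ) - hashMod P x y e b p, ?_, ?_⟩
  · set v := hashMod P x y e a p
    set w := hashMod P x y e b p
    have hv : v * 2 ^ q / P = w * 2 ^ q / P := h
    have h1 := Nat.div_add_mod (v * 2 ^ q) P
    have h2 := Nat.div_add_mod (w * 2 ^ q) P
    have h3 := Nat.mod_lt (v * 2 ^ q) hP
    have h4 := Nat.mod_lt (w * 2 ^ q) hP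
    rw [hv] at h1
    have h5 : (2 : ℤ) ^ q * ((v : ℤ) - w) =
        ((v * 2 ^ q % P : ℕ) : ℤ) - ((w * 2 ^ q % P : ℕ) : ℤ) := by
      zify at h1 h2 ⊢
      linarith
    rw [← abs_of_pos (by positivity : (0 : ℤ) < 2 ^ q), ← abs_mul, h5, abs_le]
    constructor <;> omega
  · simp only [hashMod]
    push_cast [ZMod.natCast_mod]
    rw [← Finset.sum_sub_distrib, Finset.mul_sum]
    exact Finset.sum_congr rfl fun k _ => by ring

/-- The number of parameters `(x, y)` under which all of the given `k` pairs collide. -/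
theorem card_collisions_mul_pow_le {P : ℕ} [Fact P.Prime] {n p q k S : ℕ} {X : ℕ → ℕ}
    (hX : ∀ t, X t ≤ 1) (hS : 0 < S) (hSP : S ≤ P) (hSq : 6 * S ≤ 2 ^ q) {f g : Fin k → ℕ}
    (hf : Function.Injective f) (hfn : ∀ l, f l * p + p ≤ n)
    (hd : ∀ l, ∃ t < p, X (f l * p + t) ≠ X (g l + t)) {A : Finset (ZMod P × ZMod P)}
    (hA : ∀ a ∈ A, ∀ l,
      hashNat P ((a.1 - 1).val + 1) ((a.2 - 1).val + 1) (f l * p) (fun t => X (f l * p + t)) p q =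
        hashNat P ((a.1 - 1).val + 1) ((a.2 - 1).val + 1) (f l * p) (fun t => X (g l + t)) p q) :
    A.card * S ^ k ≤ 4 ^ k * (P * (P + S ^ k * n)) := by
  have hpos : 0 < P := (Fact.out : P.Prime).pos
  have : NeZero P := ⟨hpos.ne'⟩
  have := card_mul_pow_le_of_close (linearIndependent_diffPoly (P := P) hX hf hd)
    (fun l => diffPoly_degree_lt P X (g l) (hfn l)) hS hSP (A := A) fun a ha l => by
      obtain ⟨δ, hδ, he⟩ := exists_close_of_hashNat_eq hpos (hA a ha l)
      refine ⟨δ, ?_, ?_⟩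
      · refine le_trans ?_ hδ
        gcongr
        exact_mod_cast hSq
      · rw [he, diffPoly_eval]
        simp
  simpa using this

/-- Strictly increasing `k`-tuples with values in one interval of length `L` correspond to subsets
of size `k`. -/
theorem card_strictMono_le_choose (n : ℕ) {k L : ℕ} (hL : 0 < L) (α : ℕ) :
    (Finset.univ.filter fun f : Fin k → Fin n =>
      StrictMono f ∧ ∀ l, (f l : ℕ) / L = α).card ≤ L.choose k := by
  classical
  set W := Finset.univ.filter fun i : Fin n => (i : ℕ) / L = α with hW
  have hWL : W.card ≤ L := by
    have : (W.image fun i : Fin n => (i : ℕ)) ⊆ Finset.Ico (α * L) (α * L + L) := by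
      intro t ht
      obtain ⟨i, hi, rfl⟩ := Finset.mem_image.1 ht
      have hi := (Finset.mem_filter.1 hi).2
      have h1 := Nat.div_add_mod (i : ℕ) L
      have h2 := Nat.mod_lt (i : ℕ) hL
      rw [hi, mul_comm] at h1
      exact Finset.mem_Ico.2 ⟨by omega, by omega⟩
    have := Finset.card_le_card this
    rwa [Finset.card_image_of_injective _ Fin.val_injective, Nat.card_Ico,
      Nat.add_sub_cancel_left] at this
  refine le_trans ?_ (Nat.choose_le_choose k hWL)
  rw [← Finset.card_powersetCard]
  refine Finset.card_le_card_of_injOn (fun f => Finset.univ.image f) ?_ ?_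
  · intro f hf
    obtain ⟨hm, hα⟩ := (Finset.mem_filter.1 (Finset.mem_coe.1 hf)).2
    refine Finset.mem_coe.2 (Finset.mem_powersetCard.2 ⟨?_, ?_⟩)
    · intro i hi
      obtain ⟨l, -, rfl⟩ := Finset.mem_image.1 hi
      exact Finset.mem_filter.2 ⟨Finset.mem_univ _, hα l⟩
    · rw [Finset.card_image_of_injective _ hm.injective, Finset.card_univ, Fintype.card_fin]
  · intro f hf g hg hfg
    have hf := (Finset.mem_filter.1 (Finset.mem_coe.1 hf)).2.1
    have hg := (Finset.mem_filter.1 (Finset.mem_coe.1 hg)).2.1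
    refine (hf.range_inj hg).1 ?_
    have := congrArg (fun s : Finset (Fin n) => (s : Set (Fin n))) hfg
    simpa using this

/-- The union bound: some seed admits no `k` bad pairs in increasing order whose block indices lie
in one interval `[α * L, (α + 1) * L)` and whose positions lie in one interval
`[β * L, (β + 1) * L)`. -/
theorem exists_seed_forall_not_isBad {n p q k L S N : ℕ} {X : ℕ → ℕ} (hX : ∀ t, X t ≤ 1)
    (hn : 0 < n) (hp : 0 < p) (hk : 0 < k) (hL : 0 < L) (hS : 0 < S) (hSq : 6 * S ≤ 2 ^ q)
    (hN : 2 * (n * S ^ k) ≤ N) (hcount : n * n * (L.choose k * L.choose k) * (2 * 4 ^ k) < S ^ k) :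
    ∃ z < N ^ 3, ∀ (f g : Fin k → ℕ) (α β : ℕ), StrictMono f → StrictMono g →
      (∀ l, f l / L = α) → (∀ l, g l / L = β) → (∀ l, f l * p + p ≤ n) → (∀ l, g l < n) →
      ¬ ∀ l, isBad N z p q X (f l) (g l) = true := by
  classical
  obtain ⟨P, hPp, hlt, hle⟩ := Nat.exists_prime_lt_and_le_two_mul (n * S ^ k) (by positivity)
  have : Fact P.Prime := ⟨hPp⟩
  have : NeZero P := ⟨hPp.ne_zero⟩
  have hPN : P ≤ N := hle.trans hN
  have hSP : S ≤ P := by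
    have h1 : S ≤ S ^ k := Nat.le_self_pow hk.ne' S
    nlinarith
  let H (a : ZMod P × ZMod P) (i : ℕ) (b : ℕ → ℕ) : ℕ :=
    hashNat P ((a.1 - 1).val + 1) ((a.2 - 1).val + 1) (i * p) b p q
  let Bad (a : ZMod P × ZMod P) (i j : ℕ) : Prop :=
    (∃ t < p, X (i * p + t) ≠ X (j + t)) ∧
      H a i (fun t => X (i * p + t)) = H a i (fun t => X (j + t))
  let M (α : ℕ) := Finset.univ.filter fun f : Fin k → Fin n =>
    StrictMono f ∧ ∀ l, (f l : ℕ) / L = α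
  let E : Finset ((Fin k → Fin n) × (Fin k → Fin n)) :=
    (Finset.univ : Finset (Fin n × Fin n)).biUnion fun c => M c.1 ×ˢ M c.2
  let A (e : (Fin k → Fin n) × (Fin k → Fin n)) : Finset (ZMod P × ZMod P) :=
    Finset.univ.filter fun a => ∀ l, (e.1 l : ℕ) * p + p ≤ n ∧ Bad a (e.1 l) (e.2 l)
  have hEcard : E.card ≤ n * n * (L.choose k * L.choose k) := by
    refine Finset.card_biUnion_le.trans ?_
    refine (Finset.sum_le_card_nsmul _ _ (L.choose k * L.choose k) fun c _ => ?_).trans ?_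
    · rw [Finset.card_product]
      exact Nat.mul_le_mul (card_strictMono_le_choose n hL _) (card_strictMono_le_choose n hL _)
    · simp
  have hAcard : ∀ e ∈ E, (A e).card * S ^ k ≤ 2 * 4 ^ k * (P * P) := by
    intro e he
    obtain ⟨c, -, hc⟩ := Finset.mem_biUnion.1 he
    have hm := (Finset.mem_filter.1 (Finset.mem_product.1 hc).1).2.1
    rcases (A e).eq_empty_or_nonempty with h0 | ⟨a, ha⟩
    · simp [h0]
    have ha := (Finset.mem_filter.1 ha).2
    refine (card_collisions_mul_pow_le hX hS hSP hSq (f := fun l => (e.1 l : ℕ))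
      (g := fun l => (e.2 l : ℕ)) (fun l m h => hm.injective (Fin.ext h)) (fun l => (ha l).1)
      (fun l => (ha l).2.1) fun a ha l => ((Finset.mem_filter.1 ha).2 l).2.2).trans ?_
    have : S ^ k * n ≤ P := by rw [mul_comm]; exact hlt.le
    calc 4 ^ k * (P * (P + S ^ k * n)) ≤ 4 ^ k * (P * (P + P)) := by gcongr
      _ = 2 * 4 ^ k * (P * P) := by ring
  have hex : ∃ a, ∀ e ∈ E, a ∉ A e := by
    by_contra! hall
    have hcover : (Finset.univ : Finset (ZMod P × ZMod P)) ⊆ E.biUnion A := fun a _ => by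
      obtain ⟨e, he, ha⟩ := hall a
      exact Finset.mem_biUnion.2 ⟨e, he, ha⟩
    have h1 : P * P ≤ ∑ e ∈ E, (A e).card := by
      have := (Finset.card_le_card hcover).trans Finset.card_biUnion_le
      simpa [ZMod.card] using this
    have h2 : P * P * S ^ k ≤ E.card * (2 * 4 ^ k * (P * P)) := by
      calc P * P * S ^ k ≤ (∑ e ∈ E, (A e).card) * S ^ k := by gcongr
        _ = ∑ e ∈ E, (A e).card * S ^ k := Finset.sum_mul _ _ _
        _ ≤ E.card * (2 * 4 ^ k * (P * P)) := by
          simpa using Finset.sum_le_card_nsmul _ _ _ hAcard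
    have hPP : 0 < P * P := Nat.mul_pos hPp.pos hPp.pos
    have h3 : S ^ k ≤ E.card * (2 * 4 ^ k) := by
      refine Nat.le_of_mul_le_mul_left (h2.trans (le_of_eq ?_)) hPP
      ring
    exact absurd (h3.trans (Nat.mul_le_mul_right _ hEcard)) (by omega)
  obtain ⟨a, ha⟩ := hex
  have hx : (a.1 - 1).val < N := (ZMod.val_lt _).trans_le hPN
  have hy : (a.2 - 1).val < N := (ZMod.val_lt _).trans_le hPN
  have hPN2 : P - 2 < N := by have := hPp.two_le; omega
  have hN0 : 0 < N := by omega
  set z := (P - 2) + N * ((a.1 - 1).val + N * (a.2 - 1).val) with hz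
  have z1 : z % N = P - 2 := by
    rw [hz, Nat.add_mul_mod_self_left, Nat.mod_eq_of_lt hPN2]
  have z2 : z / N = (a.1 - 1).val + N * (a.2 - 1).val := by
    rw [hz, Nat.add_mul_div_left _ _ hN0, Nat.div_eq_of_lt hPN2, zero_add]
  have z3 : z / N % N = (a.1 - 1).val := by
    rw [z2, Nat.add_mul_mod_self_left, Nat.mod_eq_of_lt hx]
  have z4 : z / N / N = (a.2 - 1).val := by
    rw [z2, Nat.add_mul_div_left _ _ hN0, Nat.div_eq_of_lt hx, zero_add]
  have hzP : z % N + 2 = P := by have := hPp.two_le; omega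
  refine ⟨z, ?_, ?_⟩
  · have h1 : (a.1 - 1).val + N * (a.2 - 1).val < N * N := by nlinarith
    have h2 : z < N * (N * N) := by
      rw [hz]
      nlinarith
    calc z < N * (N * N) := h2
      _ = N ^ 3 := by ring
  · intro f g α β hf hg hα hβ hfn hgn hbad
    have hfn' (l : Fin k) : f l < n := by
      have := hfn l
      nlinarith
    let l₀ : Fin k := ⟨0, hk⟩
    have hα' : α < n := (hα l₀) ▸ (Nat.div_le_self _ _).trans_lt (hfn' l₀)
    have hβ' : β < n := (hβ l₀) ▸ (Nat.div_le_self _ _).trans_lt (hgn l₀)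
    refine ha (fun l => ⟨f l, hfn' l⟩, fun l => ⟨g l, hgn l⟩) ?_ ?_
    · refine Finset.mem_biUnion.2 ⟨(⟨α, hα'⟩, ⟨β, hβ'⟩), Finset.mem_univ _,
        Finset.mem_product.2 ⟨?_, ?_⟩⟩
      · exact Finset.mem_filter.2 ⟨Finset.mem_univ _, fun l m h => hf h, hα⟩
      · exact Finset.mem_filter.2 ⟨Finset.mem_univ _, fun l m h => hg h, hβ⟩
    · refine Finset.mem_filter.2 ⟨Finset.mem_univ _, fun l => ⟨hfn l, ?_⟩⟩
      have := of_decide_eq_true (hbad l)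
      simp only [seedHash, hzP, z3, z4] at this
      exact this

/-- A chain with many pairs has `k` pairs in one cell of the `L × L` grid: along the chain the sum
of the two cell coordinates is nondecreasing and takes at most `2 * (n / L) + 1` values, and it
determines both coordinates. -/
theorem IsBlockChain.exists_cell {p n k L : ℕ} {g : ℕ → ℕ → Bool} {w : List (ℕ × ℕ)}
    (h : IsBlockChain p g (n / p) n w) (hp : 0 < p) (hk : 0 < k)
    (hw : (2 * (n / L) + 1) * (k - 1) < w.length) :
    ∃ (f f' : Fin k → ℕ) (α β : ℕ), StrictMono f ∧ StrictMono f' ∧ (∀ l, f l / L = α) ∧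
      (∀ l, f' l / L = β) ∧ (∀ l, f l * p + p ≤ n) ∧ (∀ l, f' l < n) ∧
      ∀ l, g (f l) (f' l) = true := by
  classical
  have hmem (l : Fin w.length) := h.mem w[l] (List.getElem_mem l.2)
  have hpw {l m : Fin w.length} (hlm : l < m) : w[l].1 < w[m].1 ∧ w[l].2 + p ≤ w[m].2 :=
    List.pairwise_iff_getElem.1 h.pairwise l m l.2 m.2 hlm
  have hfp (l : Fin w.length) : w[l].1 * p + p ≤ n := by
    have h1 : (w[l].1 + 1) * p ≤ n / p * p := Nat.mul_le_mul_right p (hmem l).1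
    have h2 := Nat.div_mul_le_self n p
    linarith
  have hf'n (l : Fin w.length) : w[l].2 < n := by have := (hmem l).2.1; omega
  have hfn (l : Fin w.length) : w[l].1 < n := by have := hfp l; nlinarith
  let d (l : Fin w.length) : ℕ := w[l].1 / L + w[l].2 / L
  obtain ⟨c, -, hc⟩ := Finset.exists_lt_card_fiber_of_mul_lt_card_of_maps_to
    (s := Finset.univ) (t := Finset.range (2 * (n / L) + 1)) (f := d) (n := k - 1)
    (fun l _ => by
      have h1 := Nat.div_le_div_right (c := L) (hfn l).le
      have h2 := Nat.div_le_div_right (c := L) (hf'n l).le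
      exact Finset.mem_range.2 (by simp only [d]; omega))
    (by simpa using hw)
  set F := Finset.univ.filter fun l => d l = c with hF
  have hkF : k ≤ F.card := by omega
  let φ := F.orderEmbOfCardLe hkF
  have hφ (l : Fin k) : d (φ l) = c :=
    (Finset.mem_filter.1 (F.orderEmbOfCardLe_mem hkF l)).2
  obtain ⟨l₀, hl₀⟩ : ∃ l₀ : Fin k, ∀ l, l₀ ≤ l := ⟨⟨0, hk⟩, fun l => Nat.zero_le l⟩
  have hcell (l : Fin k) : w[φ l].1 / L = w[φ l₀].1 / L ∧ w[φ l].2 / L = w[φ l₀].2 / L := by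
    rcases (hl₀ l).eq_or_lt with heq | hlt
    · exact heq ▸ ⟨rfl, rfl⟩
    · have h1 := hpw (φ.strictMono hlt)
      have h2 := Nat.div_le_div_right (c := L) h1.1.le
      have h3 := Nat.div_le_div_right (c := L) ((Nat.le_add_right _ p).trans h1.2)
      have h4 := (hφ l).trans (hφ l₀).symm
      simp only [d] at h4
      omega
  refine ⟨fun l => w[φ l].1, fun l => w[φ l].2, _, _, fun l m hlm => (hpw (φ.strictMono hlm)).1,
    fun l m hlm => ?_, fun l => (hcell l).1, fun l => (hcell l).2, fun l => hfp _,
    fun l => hf'n _, fun l => (hmem _).2.2⟩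
  have := (hpw (φ.strictMono hlm)).2
  change w[φ l].2 < w[φ m].2
  omega

/-! ### Existence of a good seed -/

theorem choose_mul_le_pow (k M : ℕ) : (k * M).choose k ≤ (4 * M) ^ k := by
  have h1 : (((k * M).choose k : ℕ) : ℝ) ≤ ((k * M : ℕ) : ℝ) ^ k / (k.factorial : ℝ) :=
    Nat.choose_le_pow_div k (k * M)
  have h2 : (k : ℝ) ^ k / (k.factorial : ℝ) ≤ Real.exp k :=
    Real.pow_div_factorial_le_exp _ (Nat.cast_nonneg k) k
  have h3 : Real.exp k ≤ 4 ^ k := by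
    rw [← mul_one (k : ℝ), Real.exp_nat_mul]
    gcongr
    linarith [Real.exp_one_lt_d9]
  have h4 : (((k * M).choose k : ℕ) : ℝ) ≤ (4 * M) ^ k := by
    calc (((k * M).choose k : ℕ) : ℝ) ≤ ((k * M : ℕ) : ℝ) ^ k / (k.factorial : ℝ) := h1
      _ = (k : ℝ) ^ k / (k.factorial : ℝ) * (M : ℝ) ^ k := by push_cast; ring
      _ ≤ 4 ^ k * (M : ℝ) ^ k := by gcongr; exact h2.trans h3
      _ = (4 * M) ^ k := by rw [mul_pow]
  exact_mod_cast h4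

theorem seedRange_pow_three (n : ℕ) : seedRange n ^ 3 = 2 ^ (66 * Nat.clog 2 n) := by
  rw [seedRange, ← pow_mul]
  congr 1
  ring

theorem pow_le_seedRange (n : ℕ) : n ^ 22 ≤ seedRange n := by
  rw [seedRange, mul_comm, pow_mul]
  exact Nat.pow_le_pow_left (Nat.le_pow_clog (by norm_num) n) 22

/-- If no cell of side `L` contains `k` bad pairs in increasing order, the score is small. -/
theorem exists_seed_score_le {n p q k L S : ℕ} {X : ℕ → ℕ} (hX : ∀ t, X t ≤ 1)
    (hn : 0 < n) (hp : 0 < p) (hk : 0 < k) (hL : 0 < L) (hS : 0 < S) (hSq : 6 * S ≤ 2 ^ q)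
    (hN : 2 * (n * S ^ k) ≤ n ^ 22)
    (hcount : n * n * (L.choose k * L.choose k) * (2 * 4 ^ k) < S ^ k) :
    ∃ z < 2 ^ (66 * Nat.clog 2 n), score n p q X z ≤ (2 * (n / L) + 1) * (k - 1) := by
  obtain ⟨z, hz, hbad⟩ := exists_seed_forall_not_isBad (N := seedRange n) hX hn hp hk hL hS hSq
    (hN.trans (pow_le_seedRange n)) hcount
  refine ⟨z, seedRange_pow_three n ▸ hz, ?_⟩
  by_contra! hlt
  obtain ⟨w, hw, hlen⟩ := exists_isBlockChain_length_eq p (isBad (seedRange n) z p q X) (n / p) n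
  rw [score, ← hlen] at hlt
  obtain ⟨f, g, α, β, hf, hg, hα, hβ, hfn, hgn, hfg⟩ := hw.exists_cell hp hk hlt
  exact hbad f g α β hf hg hα hβ hfn hgn hfg

/-- Long hash values: single pairs are avoided altogether. -/
theorem exists_seed_score_eq_zero {n p q : ℕ} {X : ℕ → ℕ} (hX : ∀ t, X t ≤ 1) (hn : 2 ≤ n)
    (hp : 0 < p) (hq : n ^ 12 ≤ 2 ^ q) :
    ∃ z < 2 ^ (66 * Nat.clog 2 n), score n p q X z ≤ 0 := by
  have h4 : 2 ^ 4 ≤ n ^ 4 := Nat.pow_le_pow_left hn 4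
  have h8 : n ^ 8 = n ^ 4 * n ^ 4 := by ring
  have h12 : n ^ 12 = n ^ 4 * n ^ 8 := by ring
  have h8p : 0 < n ^ 8 := by positivity
  refine exists_seed_score_le (k := 1) (L := n) (S := n ^ 8) hX (by omega) hp one_pos (by omega)
    h8p (by nlinarith) ?_ ?_
  · calc 2 * (n * (n ^ 8) ^ 1) ≤ n * (n * (n ^ 8) ^ 1) := Nat.mul_le_mul_right _ hn
      _ = n ^ 10 := by ring
      _ ≤ n ^ 22 := Nat.pow_le_pow_right (by omega) (by norm_num)
  · rw [Nat.choose_one_right, pow_one, pow_one, h8]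
    calc n * n * (n * n) * (2 * 4) = n ^ 4 * 8 := by ring
      _ < n ^ 4 * n ^ 4 := Nat.mul_lt_mul_of_pos_left (by omega) (by positivity)

/-- Short hash values: tuples of about `8 * log n / q` pairs in cells of side `4 * k / ε` are
avoided, where `1 / ε = 2 ^ (q / 100 + 1)`. -/
theorem exists_seed_score_mul_le {n p q : ℕ} {X : ℕ → ℕ} (hX : ∀ t, X t ≤ 1) (hn : 2 ≤ n)
    (hp : 0 < p) (hq : 100 ≤ q) (hqn : 2 ^ q < n ^ 12) :
    ∃ z < 2 ^ (66 * Nat.clog 2 n), score n p q X z * 2 ^ (q / 100 + 1) ≤ n := by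
  set e := q / 100 with he
  have heq : 100 * e ≤ q := by omega
  have he1 : 1 ≤ e := by omega
  set E := 2 ^ (e + 1) with hE
  have hn0 : 0 < n := by omega
  have hex : ∃ k, n ^ 8 ≤ 2 ^ (q * k) :=
    ⟨n ^ 8, Nat.lt_two_pow_self.le.trans (Nat.pow_le_pow_right (by norm_num)
      (Nat.le_mul_of_pos_left _ (by omega)))⟩
  set k := Nat.find hex with hkdef
  have hkn : n ^ 8 ≤ 2 ^ (q * k) := Nat.find_spec hex
  have hk : 0 < k := by
    by_contra! h0
    have h1 : n ^ 8 ≤ 1 := by simpa [Nat.le_zero.1 h0] using hkn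
    have : 2 ^ 8 ≤ n ^ 8 := Nat.pow_le_pow_left hn 8
    omega
  have hk1 : 2 ^ (q * (k - 1)) < n ^ 8 := by
    have := Nat.find_min hex (m := k - 1) (by omega)
    omega
  -- `E` and `2 * (k - 1)` are at most `n ^ (1 / 4)`, so that `2 * (k - 1) * E ≤ n`
  have hE4 : E ^ 4 ≤ n := by
    refine le_of_lt (lt_of_pow_lt_pow_left₀ 12 (Nat.zero_le n) (lt_of_le_of_lt ?_ hqn))
    rw [hE, ← pow_mul, ← pow_mul]
    exact Nat.pow_le_pow_right (by norm_num) (by omega)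
  have hm4 : (2 * (k - 1)) ^ 4 ≤ n := by
    have h1 : 2 * (k - 1) ≤ 2 ^ (k - 1) := by
      rcases Nat.eq_zero_or_pos (k - 1) with h | h
      · simp [h]
      · obtain ⟨m, hm⟩ := Nat.exists_eq_succ_of_ne_zero h.ne'
        rw [hm, pow_succ]
        have : m < 2 ^ m := Nat.lt_two_pow_self
        omega
    refine le_of_lt (lt_of_pow_lt_pow_left₀ 8 (Nat.zero_le n) (lt_of_le_of_lt ?_ hk1))
    calc ((2 * (k - 1)) ^ 4) ^ 8 ≤ ((2 ^ (k - 1)) ^ 4) ^ 8 := by gcongr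
      _ = 2 ^ (32 * (k - 1)) := by rw [← pow_mul, ← pow_mul]; congr 1; ring
      _ ≤ 2 ^ (q * (k - 1)) :=
        Nat.pow_le_pow_right (by norm_num) (Nat.mul_le_mul_right _ (by omega))
  have hmE : 2 * (k - 1) * E ≤ n := by
    refine le_of_pow_le_pow_left₀ (n := 4) (by norm_num) (Nat.zero_le n) ?_
    calc (2 * (k - 1) * E) ^ 4 = (2 * (k - 1)) ^ 4 * E ^ 4 := mul_pow _ _ _
      _ ≤ n * n := Nat.mul_le_mul hm4 hE4
      _ = n ^ 2 := by ring
      _ ≤ n ^ 4 := Nat.pow_le_pow_right hn0 (by norm_num)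
  have hq3 : 2 ^ q = 2 ^ (q - 3) * 8 := by
    rw [show (8 : ℕ) = 2 ^ 3 by norm_num, ← pow_add]
    congr 1
    omega
  have hSk : (2 ^ (q - 3)) ^ k ≤ n ^ 20 := by
    have hkk : q * k = q * (k - 1) + q := by
      obtain ⟨m, hm⟩ := Nat.exists_eq_succ_of_ne_zero hk.ne'
      rw [hm]; simp; ring
    calc (2 ^ (q - 3)) ^ k ≤ (2 ^ q) ^ k :=
          Nat.pow_le_pow_left (Nat.pow_le_pow_right (by norm_num) (Nat.sub_le q 3)) k
      _ = 2 ^ (q * (k - 1)) * 2 ^ q := by rw [← pow_mul, hkk, pow_add]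
      _ ≤ n ^ 8 * n ^ 12 := Nat.mul_le_mul hk1.le hqn.le
      _ = n ^ 20 := by ring
  have hE0 : 0 < E := by positivity
  have hN : 2 * (n * (2 ^ (q - 3)) ^ k) ≤ n ^ 22 := by
    calc 2 * (n * (2 ^ (q - 3)) ^ k) ≤ n * (n * n ^ 20) := by gcongr
      _ = n ^ 22 := by ring
  have hcount : n * n * ((k * (4 * E)).choose k * (k * (4 * E)).choose k) * (2 * 4 ^ k) <
      (2 ^ (q - 3)) ^ k := by
    set L := k * (4 * E) with hL
    have hch : L.choose k ≤ (2 ^ (e + 5)) ^ k := by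
      refine (choose_mul_le_pow k (4 * E)).trans (le_of_eq ?_)
      congr 1
      rw [hE]
      ring
    -- squaring avoids halving the exponent `q * k` of the lower bound for `2 ^ (q * k)`
    refine lt_of_pow_lt_pow_left₀ 2 (Nat.zero_le _) ?_
    have h4 : (4 : ℕ) ^ k = 2 ^ (2 * k) := by rw [pow_mul]; norm_num
    have hlt : 4 * n ^ 4 < n ^ 8 := by
      have h4 : 2 ^ 4 ≤ n ^ 4 := Nat.pow_le_pow_left hn 4
      have h8 : n ^ 8 = n ^ 4 * n ^ 4 := by ring
      rw [h8]
      exact Nat.mul_lt_mul_of_pos_right (by omega) (by positivity)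
    calc (n * n * (L.choose k * L.choose k) * (2 * 4 ^ k)) ^ 2
        ≤ (n * n * ((2 ^ (e + 5)) ^ k * (2 ^ (e + 5)) ^ k) * (2 * 4 ^ k)) ^ 2 := by gcongr
      _ = 4 * n ^ 4 * 2 ^ ((4 * e + 24) * k) := by
        rw [h4, ← pow_mul, show (4 * e + 24) * k = (e + 5) * k * 4 + 2 * k * 2 by ring,
          pow_add 2 ((e + 5) * k * 4), pow_mul 2 ((e + 5) * k), pow_mul 2 (2 * k)]
        generalize 2 ^ ((e + 5) * k) = a
        generalize 2 ^ (2 * k) = b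
        ring
      _ < n ^ 8 * 2 ^ ((4 * e + 24) * k) := Nat.mul_lt_mul_of_pos_right hlt (by positivity)
      _ ≤ 2 ^ (q * k) * 2 ^ ((4 * e + 24) * k) := Nat.mul_le_mul_right _ hkn
      _ = 2 ^ ((q + (4 * e + 24)) * k) := by rw [← pow_add, ← add_mul]
      _ ≤ 2 ^ ((q - 3) * 2 * k) :=
        Nat.pow_le_pow_right (by norm_num) (Nat.mul_le_mul_right _ (by omega))
      _ = ((2 ^ (q - 3)) ^ k) ^ 2 := by rw [← pow_mul, ← pow_mul]; congr 1; ring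
  obtain ⟨z, hz, hsc⟩ := exists_seed_score_le (n := n) (p := p) (q := q) (k := k)
    (L := k * (4 * E)) (S := 2 ^ (q - 3)) hX hn0 hp hk (by positivity) (by positivity) (by omega)
    hN hcount
  refine ⟨z, hz, (Nat.mul_le_mul_right E hsc).trans ?_⟩
  have h1 := Nat.div_mul_le_self n (k * (4 * E))
  have h2 : (n / (k * (4 * E))) * (k - 1) * E ≤ n / (k * (4 * E)) * k * E := by
    gcongr
    omega
  nlinarith

/-- Some seed has a score of at most `2 ^ (-(q / 100 + 1)) * n`. A score never exceeds the number
`n / p` of blocks, so only the case `q ≤ p < 2 ^ (q / 100 + 1)` matters; then `p = q = 1` or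
`q ≥ 100`. -/
theorem exists_good_seed {n p q : ℕ} {X : ℕ → ℕ} (hX : ∀ t, X t ≤ 1) (hq : 1 ≤ q) (hqp : q ≤ p)
    (hpn : p ≤ n) :
    ∃ z < 2 ^ (66 * Nat.clog 2 n), score n p q X z * 2 ^ (q / 100 + 1) ≤ n := by
  rcases Nat.lt_or_ge p (2 ^ (q / 100 + 1)) with hpE | hpE
  · rcases Nat.eq_or_lt_of_le (hq.trans hqp) with rfl | hp2
    · -- the hash functions with the seed `0` are the identity on single bits
      obtain rfl : q = 1 := by omega
      refine ⟨0, by positivity, ?_⟩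
      obtain ⟨w, hw, hlen⟩ :=
        exists_isBlockChain_length_eq 1 (isBad (seedRange n) 0 1 1 X) (n / 1) n
      have hw0 : w = [] := by
        refine List.eq_nil_iff_forall_not_mem.2 fun a ha => ?_
        obtain ⟨⟨k, hk, hne⟩, heq⟩ := of_decide_eq_true (hw.mem a ha).2.2
        obtain rfl : k = 0 := by omega
        have h1 := hX (a.1 * 1 + 0)
        have h2 := hX (a.2 + 0)
        simp [seedHash, hashNat, hashMod] at heq hne h1 h2
        omega
      rw [score, ← hlen, hw0]
      simp
    · have hq100 : 100 ≤ q := by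
        by_contra! h
        rw [Nat.div_eq_of_lt h] at hpE
        omega
      rcases Nat.lt_or_ge (2 ^ q) (n ^ 12) with h | h
      · exact exists_seed_score_mul_le hX (by omega) (by omega) hq100 h
      · obtain ⟨z, hz, h0⟩ := exists_seed_score_eq_zero (p := p) hX (by omega) (by omega) h
        exact ⟨z, hz, by simp [Nat.le_zero.1 h0]⟩
  · refine ⟨0, by positivity, ?_⟩
    calc score n p q X 0 * 2 ^ (q / 100 + 1) ≤ n / p * p :=
          Nat.mul_le_mul (longestChain_le _ _ _ _) hpE
      _ ≤ n := Nat.div_mul_le_self n p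

/-! ### The generator and the evaluator on their inputs -/

/-- A string as a function on the natural numbers, as it appears in the memory of the RAM. -/
def bitFun {n : ℕ} (x : Fin n → Bool) (k : ℕ) : ℕ := ((List.ofFn x).getD k false).toNat

theorem bitFun_of_lt {n : ℕ} (x : Fin n → Bool) {k : ℕ} (hk : k < n) :
    bitFun x k = (x ⟨k, hk⟩).toNat := by
  simp [bitFun, hk]

theorem bitFun_le_one {n : ℕ} (x : Fin n → Bool) (k : ℕ) : bitFun x k ≤ 1 := Bool.toNat_le _

theorem bitFun_substr {n p j : ℕ} (x : Fin n → Bool) (hj : j + p ≤ n) {k : ℕ} (hk : k < p) :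
    bitFun (substr x j p) k = bitFun x (j + k) := by
  rw [bitFun_of_lt _ hk, bitFun_of_lt x (by omega : j + k < n), substr, dif_pos]

theorem seedHash_congr {N z e p q : ℕ} {a b : ℕ → ℕ} (h : ∀ k < p, a k = b k) :
    seedHash N z e a p q = seedHash N z e b p q := by
  have h' (P x y : ℕ) : hashMod P x y e a p = hashMod P x y e b p := by
    rw [hashMod, hashMod,
      Finset.sum_congr rfl fun k hk => by rw [h k (Finset.mem_range.1 hk)]]
  simp [seedHash, hashNat, h']

theorem seedHash_lt (N z e p q : ℕ) (a : ℕ → ℕ) : seedHash N z e a p q < 2 ^ q := by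
  have h : 0 < z % N + 2 := Nat.succ_pos _
  rw [seedHash, hashNat, Nat.div_lt_iff_lt_mul h, mul_comm]
  exact Nat.mul_lt_mul_of_pos_left (Nat.mod_lt _ h) (by positivity)

/-- The hash functions described by the seed `z`: the binary digits of `seedHash`. -/
def hashFun (n p q z i : ℕ) (a : Fin p → Bool) (t : Fin q) : Bool :=
  (seedHash (seedRange n) z (i * p) (bitFun a) p q).testBit t

theorem seedHash_eq_of_hashFun_eq {n p q z i : ℕ} {a b : Fin p → Bool}
    (h : hashFun n p q z i a = hashFun n p q z i b) :
    seedHash (seedRange n) z (i * p) (bitFun a) p q =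
      seedHash (seedRange n) z (i * p) (bitFun b) p q := by
  refine Nat.eq_of_testBit_eq fun t => ?_
  rcases Nat.lt_or_ge t q with ht | ht
  · exact congrFun h ⟨t, ht⟩
  · have (m : ℕ) (hm : m < 2 ^ q) : m.testBit t = false :=
      Nat.testBit_lt_two_pow (hm.trans_le (Nat.pow_le_pow_right (by norm_num) ht))
    rw [this _ (seedHash_lt ..), this _ (seedHash_lt ..)]

theorem numBad_le_score {n n' p q z : ℕ} (hn : n = n' * p) (hp : 0 < p) {x : Fin n → Bool}
    {w : List (Fin n' × Fin n)}
    (hw : IsMatching (fun i => hashFun n p q z i) (blocks x n' p) x w) :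
    numBad (blocks x n' p) x w ≤ score n p q (bitFun x) z := by
  rw [numBad, List.countP_eq_length_filter,
    ← List.length_map (f := fun a : Fin n' × Fin n => ((a.1 : ℕ), (a.2 : ℕ)))]
  refine IsBlockChain.length_le ⟨?_, ?_⟩
  · rw [List.pairwise_map]
    exact ((hw.left_lt.and hw.right_lt).filter _).imp fun h => ⟨h.1, h.2⟩
  · intro b hb
    obtain ⟨a, ha, rfl⟩ := List.mem_map.1 hb
    obtain ⟨haw, hne⟩ := List.mem_filter.1 ha
    have hi : (a.1 : ℕ) * p + p ≤ n := by
      have := Nat.mul_le_mul_right p a.1.2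
      rw [Nat.succ_mul, ← hn] at this
      exact this
    have hj := hw.right_le a haw
    refine ⟨?_, hj, ?_⟩
    · have hdiv : n / p = n' := by rw [hn, Nat.mul_div_cancel _ hp]
      exact hdiv ▸ a.1.2
    · refine decide_eq_true ⟨?_, ?_⟩
      · by_contra! hall
        refine of_decide_eq_true hne (funext fun k => ?_)
        have h1 : (a.1 : ℕ) * p + k < n := by omega
        have h2 : (a.2 : ℕ) + k < n := by omega
        have := hall k k.2
        rw [bitFun_of_lt x h1, bitFun_of_lt x h2] at this
        rw [blocks, substr, substr, dif_pos h1, dif_pos h2]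
        exact (by decide : ∀ b c : Bool, b.toNat = c.toNat → b = c) _ _ this
      · have := seedHash_eq_of_hashFun_eq (hw.hash_eq a haw)
        rw [blocks, seedHash_congr fun k hk => bitFun_substr x hi hk,
          seedHash_congr (b := fun k => bitFun x (a.2 + k))
            fun k hk => bitFun_substr x hj hk] at this
        exact this

/-- The hypothesis `c * logb 2 (1 / ε) ≤ q` means that `ε ≥ 2 ^ (-(q / c))`, which is more than
`2 ^ (-(q / c + 1))` with the rounded quotient. -/
theorem le_mul_of_logb_le {c q : ℕ} (hc : 0 < c) {ε : ℝ} (hε : 0 < ε)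
    (h : c * Real.logb 2 (1 / ε) ≤ q) {m n : ℕ} (hm : m * 2 ^ (q / c + 1) ≤ n) :
    (m : ℝ) ≤ ε * n := by
  have hc' : (0 : ℝ) < c := by exact_mod_cast hc
  have hq : (q : ℝ) ≤ c * ((q / c + 1 : ℕ) : ℝ) := by
    have := Nat.lt_mul_div_succ q hc
    exact_mod_cast this.le
  have h1 : Real.logb 2 (1 / ε) ≤ ((q / c + 1 : ℕ) : ℝ) :=
    le_of_mul_le_mul_left (h.trans hq) hc'
  rw [Real.logb_le_iff_le_rpow (by norm_num) (by positivity), Real.rpow_natCast,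
    div_le_iff₀ hε] at h1
  have h2 : (m : ℝ) * 2 ^ (q / c + 1) ≤ n := by exact_mod_cast hm
  calc (m : ℝ) ≤ m * (2 ^ (q / c + 1) * ε) := by
        have : (0 : ℝ) ≤ m := Nat.cast_nonneg m
        nlinarith
    _ = ε * (m * 2 ^ (q / c + 1)) := by ring
    _ ≤ ε * n := by gcongr

theorem clog_le_two_mul_logb {n : ℕ} (hn : 1 ≤ n) : (Nat.clog 2 n : ℝ) ≤ 2 * Real.logb 2 n := by
  rcases Nat.eq_or_lt_of_le hn with rfl | h2
  · simp
  · have hn0 : (0 : ℝ) < n := by positivity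
    have h3 : (1 : ℝ) ≤ Real.logb 2 n := by
      rw [Real.le_logb_iff_rpow_le (by norm_num) hn0, Real.rpow_one]
      exact_mod_cast h2
    have h4 : 2 ^ (Nat.clog 2 n - 1) < n := Nat.pow_pred_clog_lt_self (by norm_num) h2
    have h5 : ((Nat.clog 2 n - 1 : ℕ) : ℝ) ≤ Real.logb 2 n := by
      rw [Real.le_logb_iff_rpow_le (by norm_num) hn0, Real.rpow_natCast]
      exact_mod_cast h4.le
    have h6 : (Nat.clog 2 n : ℝ) ≤ ((Nat.clog 2 n - 1 : ℕ) : ℝ) + 1 := by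
      exact_mod_cast (by omega : Nat.clog 2 n ≤ Nat.clog 2 n - 1 + 1)
    linarith

theorem two_pow_clog_le (n : ℕ) : 2 ^ Nat.clog 2 n ≤ 2 * (n + 1) := by
  rcases Nat.lt_or_ge 1 n with h | h
  · have h1 : 2 ^ (Nat.clog 2 n - 1) < n := Nat.pow_pred_clog_lt_self (by norm_num) h
    have h2 : 0 < Nat.clog 2 n := Nat.clog_pos (by norm_num) h
    obtain ⟨m, hm⟩ := Nat.exists_eq_succ_of_ne_zero h2.ne'
    rw [hm] at h1 ⊢
    rw [pow_succ]
    simp at h1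
    omega
  · rw [Nat.clog_of_right_le_one h]
    omega

/-- A bound for the number of steps of both programs. -/
def stepBound (n : ℕ) : ℕ := (2 * (n + 1)) ^ 66 * (60 * (n + 1) ^ 3) + 300 * (n + 1)

/-- A polynomial bound for the logarithmic cost of both programs, where `K` is a constant that
depends on the programs. -/
noncomputable def costBound (K : ℕ) : Polynomial ℕ :=
  let G : Polynomial ℕ := (2 * (Polynomial.X + 1)) ^ 66 * (60 * (Polynomial.X + 1) ^ 3) +
    300 * (Polynomial.X + 1)
  G * (((K : Polynomial ℕ) + 1) *
    (66 * (Polynomial.X + 1) + 1 + ((K : Polynomial ℕ) + 1) * G + 1))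

theorem costBound_eval (K n : ℕ) : (costBound K).eval n =
    stepBound n * ((K + 1) * (66 * (n + 1) + 1 + (K + 1) * stepBound n + 1)) := by
  simp [costBound, stepBound]

namespace RAM

theorem genProg_outputsInTime {K n p q : ℕ} (hK : genProg.BoundedBy (K + 1)) (hp : p ≤ n)
    (hq : q ≤ n) (x : Fin n → Bool) :
    ∃ z < 2 ^ (66 * Nat.clog 2 n),
      (∀ z' < 2 ^ (66 * Nat.clog 2 n),
        score n p q (bitFun x) z ≤ score n p q (bitFun x) z') ∧
      genProg.OutputsInTime [n, p, q] [List.ofFn x]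
        (List.ofFn fun k : Fin (66 * Nat.clog 2 n) => z.testBit k) ((costBound K).eval n) := by
  obtain ⟨s', t, hr, ht, z, hz, hmin, h0, hbits⟩ :=
    reach_genProg (Store.init [n, p, q] [List.ofFn x]) hp hq
  refine ⟨z, hz, hmin, Reach.outputsInTime (N := stepBound n) (K := K) (M := 66 * (n + 1))
    ⟨s', t, hr, ht.trans ?_, ?_, fun k hk => ?_⟩ hK ?_ (costBound_eval K n).ge⟩
  · change 2 ^ (66 * Nat.clog 2 n) * (60 * (n + 1) ^ 3) + 300 * (n + 1) ≤ stepBound n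
    rw [stepBound, mul_comm 66, pow_mul]
    gcongr
    exact two_pow_clog_le n
  · rw [List.length_ofFn]
    exact h0
  · rw [List.length_ofFn] at hk
    rw [List.getElem_ofFn, Nat.toNat_testBit]
    exact hbits k hk
  · simp
    omega

theorem evalProg_outputsInTime {K n p q i z : ℕ} (hK : evalProg.BoundedBy (K + 1)) (hp : p ≤ n)
    (hq : q ≤ n) (hi : i * p ≤ n) (hin : i ≤ n) (hz : z < 2 ^ (66 * Nat.clog 2 n))
    (a : Fin p → Bool) :
    evalProg.OutputsInTime [n, p, q, i, 66 * Nat.clog 2 n]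
      [List.ofFn fun k : Fin (66 * Nat.clog 2 n) => z.testBit k, List.ofFn a]
      (List.ofFn (hashFun n p q z i a)) ((costBound K).eval n) := by
  have hclog : Nat.clog 2 n ≤ n := Nat.clog_le_of_le_pow Nat.lt_two_pow_self.le
  obtain ⟨s', t, hr, ht, h0, hbits⟩ := reach_evalProg (Store.init
    [n, p, q, i, 66 * Nat.clog 2 n]
    [List.ofFn fun k : Fin (66 * Nat.clog 2 n) => z.testBit k, List.ofFn a]) hz
    (fun k hk => by
      change k < 66 * Nat.clog 2 n at hk
      change ((List.ofFn fun k : Fin (66 * Nat.clog 2 n) => z.testBit k).getD k false).toNat = _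
      rw [← Nat.toNat_testBit]
      simp [hk]) hp hq hi
  refine Reach.outputsInTime (N := stepBound n) (K := K) (M := 66 * (n + 1))
    ⟨s', t, hr, ht.trans ?_, ?_, fun k hk => ?_⟩ hK ?_ (costBound_eval K n).ge
  · change 21 * n + 3 * (66 * Nat.clog 2 n) + 40 ≤ stepBound n
    rw [stepBound]
    omega
  · rw [List.length_ofFn]
    exact h0
  · rw [List.length_ofFn] at hk
    rw [List.getElem_ofFn, hashFun, Nat.toNat_testBit]
    exact hbits k hk
  · simp
    omega

end RAM

theorem mainTheorem8 :
    ∃ c₁ : ℝ, 0 < c₁ ∧ ∀ c₂ : ℝ,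
      ∃ (gen ev : RAM.Prog) (P : Polynomial ℕ) (C : ℝ),
        ∀ (n n' p q : ℕ) (ε : ℝ) (x : Fin n → Bool),
          n = n' * p → p ≤ n → q ≤ p → 0 < ε → ε < 1 →
          c₁ * Real.logb 2 (1 / ε) ≤ q → (q : ℝ) ≤ c₂ * Real.logb 2 (1 / ε) →
          ∃ (u : List Bool) (h : Fin n' → (Fin p → Bool) → (Fin q → Bool)),
            gen.OutputsInTime [n, p, q] [List.ofFn x] u (P.eval n) ∧
            (u.length : ℝ) ≤ C * Real.logb 2 n ∧
            IsSelfMatching ε x h ∧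
            ∀ (i : Fin n') (a : Fin p → Bool),
              ev.OutputsInTime [n, p, q, i, u.length] [u, List.ofFn a] (List.ofFn (h i a))
                (P.eval n) := by
  obtain ⟨K₁, h₁⟩ := RAM.Prog.exists_boundedBy (c := RAM.genProg) rfl
  obtain ⟨K₂, h₂⟩ := RAM.Prog.exists_boundedBy (c := RAM.evalProg) rfl
  refine ⟨(100 : ℕ), by norm_num, fun _ =>
    ⟨RAM.genProg, RAM.evalProg, costBound (K₁ + K₂), 132, ?_⟩⟩
  intro n n' p q ε x hn hpn hqp hε hε1 hlog _
  have hlog0 : 0 < Real.logb 2 (1 / ε) :=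
    Real.logb_pos (by norm_num) (by rwa [lt_div_iff₀ hε, one_mul])
  have hq : 1 ≤ q := by
    have : (0 : ℝ) < q := lt_of_lt_of_le (by positivity) hlog
    exact_mod_cast this
  obtain ⟨z, hz, hmin, hgen⟩ := RAM.genProg_outputsInTime (K := K₁ + K₂)
    (h₁.mono (by omega)) hpn (hqp.trans hpn) x
  obtain ⟨z', hz', hgood⟩ := exists_good_seed (bitFun_le_one x) hq hqp hpn
  refine ⟨_, fun i => hashFun n p q z i, hgen, ?_, fun w hw => ?_, fun i a => ?_⟩
  · have := clog_le_two_mul_logb (hq.trans (hqp.trans hpn))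
    rw [List.length_ofFn]
    push_cast
    linarith
  · refine le_mul_of_logb_le (by norm_num) hε hlog (le_trans (Nat.mul_le_mul_right _ ?_) hgood)
    exact (numBad_le_score hn (hq.trans hqp) hw).trans (hmin z' hz')
  · have hip : (i : ℕ) * p ≤ n := hn ▸ Nat.mul_le_mul_right p i.2.le
    have hin : (i : ℕ) ≤ n := (Nat.le_mul_of_pos_right _ (hq.trans hqp)).trans hip
    rw [List.length_ofFn]
    exact RAM.evalProg_outputsInTime (h₂.mono (by omega)) hpn (hqp.trans hpn) hip hin hz a
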